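/- Let $M$ be a closed smooth $n$-manifold, $\theta$ the Liouville one-form on $T^*M$ and $\omega=-d\theta$. Let $N$ be a smooth $n$-manifold, and fix smooth Riemannian metrics on $N$ and on $T^*M$. Let $\iota:N\to T^*M$ be an injective continuous map and $S:N\to\mathbb R$ a continuous function such that $(N,\iota,S)$ is a Lipschitz-exact Lagrangian brane: there are smooth embeddings $\iota_k:N\to T^*M$ and smooth functions $S_k:N\to\mathbb R$, Lipschitz with a constant independent of $k$, such that $\iota_k^*\theta=dS_k$ for every $k$, and $\iota_k\to\iota$, $S_k\to S$ uniformly on $N$. Then $\iota$ and $S$ are differentiable almost everywhere, $\iota^*\theta$ and $dS$ (defined almost everywhere by the pointwise derivatives) are one-forms in $L^\infty$, and $$\iota^*\theta=dS$$ as one-forms in $L^\infty$, that is, almost everywhere on $N$. The identity also holds weakly, as currents: $\iota^*\theta$ is the weak differential of $S$, i.e. for every chart $e$ of $N$ with image $V\subset\mathbb R^n$, every $\varphi\in C_c^\infty(V)$ and every $v\in\mathbb R^n$, $$-\int_V (S\circ e^{-1})\,\partial_v\varphi\,dy=\int_V \big((e^{-1})^*\iota^*\theta\big)(v)\,\varphi\,dy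 .$$ Moreover $\iota^*\omega=0$ as a two-form in $L^\infty$, that is, $\omega_{\iota(x)}(d\iota_x u,d\iota_x w)=0$ for almost every $x\in N$ and all $u,w\in T_xN$. -/

import Mathlib

open scoped Manifold ContDiff Topology NNReal ENNReal
open Bundle MeasureTheory Filter

noncomputable section

namespace LipLag

/-! ### Forms on manifolds -/

section Forms

variable {E : Type*} [NormedAddCommGroup E] [NormedSpace ℝ E] {H : Type*} [TopologicalSpace H]

/-- A (not necessarily continuous) field of covectors on the manifold `X`. -/
abbrev OneForm (I : ModelWithCorners ℝ E H) (X : Type*) [TopologicalSpace X]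
    [ChartedSpace H X] : Type _ :=
  ∀ x : X, TangentSpace I x →L[ℝ] ℝ

/-- A (not necessarily continuous) field of alternating bilinear forms on the manifold `X`. -/
abbrev TwoForm (I : ModelWithCorners ℝ E H) (X : Type*) [TopologicalSpace X]
    [ChartedSpace H X] : Type _ :=
  ∀ x : X, TangentSpace I x [⋀^Fin 2]→L[ℝ] ℝ

variable {I : ModelWithCorners ℝ E H} {X : Type*} [TopologicalSpace X] [ChartedSpace H X]

/-- The differential of a real function, as a field of covectors (zero at the points where the
function is not differentiable). -/
def diff (I : ModelWithCorners ℝ E H) (f : X → ℝ) : OneForm I X :=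
  fun x => mvfderiv I f x

/-- The expression of a one-form `α` in the extended chart at `x₀`, a one-form on the model space:
the pullback of `α` by the inverse of the chart. -/
def OneForm.inExtChart (α : OneForm I X) (x₀ : X) (y : E) : E →L[ℝ] ℝ :=
  ((α ((extChartAt I x₀).symm y)).comp (mfderiv 𝓘(ℝ, E) I (extChartAt I x₀).symm y)).comp
    (NormedSpace.fromTangentSpace (𝕜 := ℝ) y).symm.toContinuousLinearMap

/-- The exterior derivative of a (differentiable) one-form on a manifold without boundary: it is
computed at `x` in the chart at `x`, and pulled back to the tangent space at `x`. -/
def OneForm.extDeriv [I.Boundaryless] (α : OneForm I X) : TwoForm I X :=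
  fun x =>
    (_root_.extDeriv
        (fun y : E => ContinuousAlternatingMap.ofSubsingleton ℝ E ℝ (0 : Fin 1)
          (OneForm.inExtChart α x y))
        (extChartAt I x x)).compContinuousLinearMap
      (mvfderiv I (extChartAt I x) x)

variable {E' : Type*} [NormedAddCommGroup E'] [NormedSpace ℝ E'] {H' : Type*}
  [TopologicalSpace H'] {I' : ModelWithCorners ℝ E' H'} {Y : Type*} [TopologicalSpace Y]
  [ChartedSpace H' Y]

/-- The pullback `f^*α` of a one-form, `(f^*α)_x(v) = α_{f(x)}(df_x v)`, which is meaningful at the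
points where `f` is differentiable. -/
def OneForm.pullback (I : ModelWithCorners ℝ E H) (f : X → Y) (α : OneForm I' Y) :
    OneForm I X :=
  fun x => (α (f x)).comp (mfderiv I I' f x)

/-- The pullback `f^*β` of a two-form, `(f^*β)_x(u, v) = β_{f(x)}(df_x u, df_x v)`, which is
meaningful at the points where `f` is differentiable. -/
def TwoForm.pullback (I : ModelWithCorners ℝ E H) (f : X → Y) (β : TwoForm I' Y) :
    TwoForm I X :=
  fun x => (β (f x)).compContinuousLinearMap (mfderiv I I' f x)

end Forms

/-! ### Riemannian metrics -/

section Metric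

variable {E : Type*} [NormedAddCommGroup E] [NormedSpace ℝ E] {H : Type*} [TopologicalSpace H]

/-- A smooth Riemannian metric on the manifold `X`. -/
abbrev RiemMetric (I : ModelWithCorners ℝ E H) (X : Type*) [TopologicalSpace X]
    [ChartedSpace H X] [IsManifold I ∞ X] : Type _ :=
  ContMDiffRiemannianMetric I ∞ E (fun x : X => TangentSpace I x)

variable {I : ModelWithCorners ℝ E H} {X : Type*} [TopologicalSpace X] [ChartedSpace H X]
  [IsManifold I ∞ X]

/-- The geodesic distance of a Riemannian metric: the infimum of the lengths of `C^1` paths (it is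
infinite between points of different components). -/
def RiemMetric.dist (g : RiemMetric I X) (x y : X) : ℝ≥0∞ :=
  letI : RiemannianBundle (fun x : X => TangentSpace I x) := ⟨g.toRiemannianMetric⟩
  Manifold.riemannianEDist I x y

/-- The length of a tangent vector. -/
def RiemMetric.length (g : RiemMetric I X) (x : X) (v : TangentSpace I x) : ℝ :=
  Real.sqrt (g.inner x v v)

end Metric

/-! ### The cotangent bundle -/

section Cotangent

/-- The cotangent bundle `T^*M` of an `n`-manifold. -/
abbrev Cotangent (n : ℕ) (M : Type*) [TopologicalSpace M]
    [ChartedSpace (EuclideanSpace ℝ (Fin n)) M] [IsManifold (𝓡 n) ∞ M] : Type _ :=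
  TotalSpace (EuclideanSpace ℝ (Fin n) →L[ℝ] ℝ)
    (fun x : M => TangentSpace (𝓡 n) x →L[ℝ] Bundle.Trivial M ℝ x)

/-- The model with corners of the manifold `T^*M`. -/
abbrev cotModel (n : ℕ) :=
  (𝓡 n).prod 𝓘(ℝ, EuclideanSpace ℝ (Fin n) →L[ℝ] ℝ)

variable {n : ℕ} {M : Type*} [TopologicalSpace M]
  [ChartedSpace (EuclideanSpace ℝ (Fin n)) M] [IsManifold (𝓡 n) ∞ M]

/-- The Liouville one-form `θ` of `T^*M`: `θ_{(q,p)}(v) = p(dπ(v))`, where `π : T^*M → M`. -/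
def liouville (n : ℕ) (M : Type*) [TopologicalSpace M]
    [ChartedSpace (EuclideanSpace ℝ (Fin n)) M] [IsManifold (𝓡 n) ∞ M] :
    OneForm (cotModel n) (Cotangent n M) :=
  fun z => (z.2 : TangentSpace (𝓡 n) z.1 →L[ℝ] ℝ).comp
    (mfderiv (cotModel n) (𝓡 n) (TotalSpace.proj : Cotangent n M → M) z)

/-- The symplectic form `ω = -dθ` of `T^*M`. -/
def symplectic (n : ℕ) (M : Type*) [TopologicalSpace M]
    [ChartedSpace (EuclideanSpace ℝ (Fin n)) M] [IsManifold (𝓡 n) ∞ M] :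
    TwoForm (cotModel n) (Cotangent n M) :=
  fun z => -(OneForm.extDeriv (liouville n M) z)

variable {N : Type*} [TopologicalSpace N] [ChartedSpace (EuclideanSpace ℝ (Fin n)) N]
  [IsManifold (𝓡 n) ∞ N]

/-- A Lipschitz-exact Lagrangian brane `(N, ι, S)` in `T^*M`: an injective continuous map
`ι : N → T^*M` and a continuous function `S` which are uniform limits of equi-Lipschitz sequences of
smooth embeddings `ι_k` and smooth functions `S_k` with `ι_k^*θ = dS_k`. Lipschitz constants and
uniform convergence refer to the Riemannian metrics `gN` of `N` and `gX` of `T^*M`. -/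
structure IsLipschitzExactBrane (gN : RiemMetric (𝓡 n) N)
    (gX : RiemMetric (cotModel n) (Cotangent n M)) (ι : N → Cotangent n M) (S : N → ℝ) :
    Prop where
  injective : Function.Injective ι
  continuous_map : Continuous ι
  continuous_primitive : Continuous S
  exists_approx : ∃ (ιk : ℕ → N → Cotangent n M) (Sk : ℕ → N → ℝ) (K : ℝ≥0),
    (∀ k, Manifold.IsSmoothEmbedding (𝓡 n) (cotModel n) ∞ (ιk k)) ∧
    (∀ k, ContMDiff (𝓡 n) 𝓘(ℝ, ℝ) ∞ (Sk k)) ∧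
    (∀ k x y, gX.dist (ιk k x) (ιk k y) ≤ K * gN.dist x y) ∧
    (∀ k x y, edist (Sk k x) (Sk k y) ≤ K * gN.dist x y) ∧
    (∀ k, OneForm.pullback (𝓡 n) (ιk k) (liouville n M) = diff (𝓡 n) (Sk k)) ∧
    (∀ ε : ℝ≥0∞, 0 < ε → ∀ᶠ k in atTop, ∀ x, gX.dist (ιk k x) (ι x) < ε) ∧
    TendstoUniformly Sk S atTop

end Cotangent

/-! ### `L^∞` forms and weak differentials -/

section Linfty

variable {n : ℕ} {N : Type*} [TopologicalSpace N] [ChartedSpace (EuclideanSpace ℝ (Fin n)) N]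
  [IsManifold (𝓡 n) ∞ N]

/-- A property holds almost everywhere on the manifold `N`: its failure set is Lebesgue-null in every
chart of the smooth structure. -/
def AlmostEverywhere (n : ℕ) {N : Type*} [TopologicalSpace N]
    [ChartedSpace (EuclideanSpace ℝ (Fin n)) N] [IsManifold (𝓡 n) ∞ N] (P : N → Prop) : Prop :=
  ∀ e ∈ IsManifold.maximalAtlas (𝓡 n) ∞ N,
    ∀ᵐ y ∂((volume : Measure (EuclideanSpace ℝ (Fin n))).restrict e.target), P (e.symm y)

/-- The expression of a one-form in the chart `e`, meaningful on `e.target`. -/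
def OneForm.inChart (e : OpenPartialHomeomorph N (EuclideanSpace ℝ (Fin n)))
    (α : OneForm (𝓡 n) N) (y : EuclideanSpace ℝ (Fin n)) : EuclideanSpace ℝ (Fin n) →L[ℝ] ℝ :=
  ((α (e.symm y)).comp (mfderiv 𝓘(ℝ, EuclideanSpace ℝ (Fin n)) (𝓡 n) e.symm y)).comp
    (NormedSpace.fromTangentSpace (𝕜 := ℝ) y).symm.toContinuousLinearMap

/-- The field of covectors `α` is a one-form in `L^∞`: it is measurable and its pointwise norm with
respect to the Riemannian metric `g` is essentially bounded. -/
structure IsLinftyOneForm (g : RiemMetric (𝓡 n) N) (α : OneForm (𝓡 n) N) : Prop where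
  measurable : ∀ e ∈ IsManifold.maximalAtlas (𝓡 n) ∞ N,
    AEStronglyMeasurable (OneForm.inChart e α)
      ((volume : Measure (EuclideanSpace ℝ (Fin n))).restrict e.target)
  bounded : ∃ C : ℝ, AlmostEverywhere n
    (fun x => ∀ v : TangentSpace (𝓡 n) x, |α x v| ≤ C * g.length x v)

/-- `α` is the weak differential of `S`, that is `dS = α` as currents. A test form of degree `n - 1`
(odd, so that no orientation is needed) supported in a chart domain is a sum of forms which read
`φ i_v(dy_1 ∧ ... ∧ dy_n)` in the chart, with `φ` a test function and `v` a constant vector; on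
such a form, the identity `-∫ S dη = ∫ α ∧ η` is the one below. -/
def IsWeakDifferential (S : N → ℝ) (α : OneForm (𝓡 n) N) : Prop :=
  ∀ e ∈ IsManifold.maximalAtlas (𝓡 n) ∞ N, ∀ φ : EuclideanSpace ℝ (Fin n) → ℝ,
    ContDiff ℝ ∞ φ → HasCompactSupport φ → tsupport φ ⊆ e.target →
    ∀ v : EuclideanSpace ℝ (Fin n),
      -∫ y in e.target, S (e.symm y) * fderiv ℝ φ y v =
        ∫ y in e.target, OneForm.inChart e α y v * φ y

end Linfty

end LipLag

end

/-!
The equality `ι^*θ = dS` and the vanishing of `ι^*ω` hold at *every* point `x` where `ι` and `S` are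
differentiable, and there are almost no other points by Rademacher's theorem.

In the chart of `T^*M` centred at `z₀ = ι x`, the Liouville form reads `p dq`
(`liouville_inExtChartAt`), and `-ω` reads `dp ∧ dq` (`extDeriv_liouville_inExtChartAt`). In this
chart and a chart of `N`, the smooth embeddings become maps `F_k = (q_k, p_k)` with `ds_k = p_k dq_k`.
Riemannian distances are comparable with the distances of charts, so that the `F_k` are uniformly
Lipschitz near `x` and converge uniformly to the expression `F = (q, p)` of `ι`
(`exists_chart_control`).

Let `(Q, P)` be the derivative of `F` at `0` and normalize `F 0 = 0`. On a ball of radius `ε` and for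
large `k`, the exact form `p_k dq_k` differs by `o(ε)` from `(P z) dq_k`, because `|dq_k|` is bounded.
Moreover `(P z) dq_k = d((P z) q_k) - q_k d(P z)`, where `q_k` no longer carries a derivative and can
be replaced by `Q z`, again with an error `o(ε)`. Hence, up to exact forms and an error `o(ε)`, the
constant coefficient form `A(z, v) = (P z (Q v) - P v (Q z)) / 2` vanishes. Its integral along a
triangle of size `ε` is of order `ε²` unless `A = 0`, whereas the error contributes `o(ε²)`. So
`A = 0`, which is `ι^*ω = 0`, and the same estimate along a ray gives `dS = ι^*θ`. The integrals are
avoided: `primitiveCorrection_estimate` is a mean value inequality for an approximate primitive of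
`A`, and `limit_of_exact_approximations` draws both conclusions.

The `L^∞` bound of `dS` comes from `|dS(v)| ≤ K |v|` for a `K`-Lipschitz function
(`abs_fderiv_le_of_lipschitz`), and the weak identity from integration by parts for the locally
Lipschitz function `S` (`neg_integral_mul_fderiv_eq`).
-/

namespace LipLag

/-! ### Limits of exact one-forms `p_k dq_k` at a point of differentiability -/

section Analytic

variable {E V : Type*} [NormedAddCommGroup E] [NormedSpace ℝ E]
  [NormedAddCommGroup V] [NormedSpace ℝ V]

/-- The antisymmetrization `A(z, v) = (P z (Q v) - P v (Q z)) / 2` of the bilinear form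
`(z, v) ↦ P z (Q v)`. For fixed `z` it is a covector in `v`, so `A` is also a one-form on `E` with
linear coefficients. -/
noncomputable def antisym (Q : E →L[ℝ] V) (P : E →L[ℝ] V →L[ℝ] ℝ) (z v : E) : ℝ :=
  (P z (Q v) - P v (Q z)) / 2

/-- The function `z ↦ s - p₀ q - (P z) (q - q₀) + (P z) (Q z) / 2`, with `s` and `q` taken at `y₀ + z`.
If `ds = p dq`, where `q` and `p` are close to `q₀ + Q z` and `p₀ + P z`, it is an approximate
primitive of the one-form `antisym Q P`: the term `(P z) (q - q₀)` integrates by parts, and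
`(P z) (Q z) / 2` removes the symmetric, hence exact, part of `-P v (Q z)`. -/
noncomputable def primitiveCorrection (q₀ : V) (p₀ : V →L[ℝ] ℝ) (Q : E →L[ℝ] V)
    (P : E →L[ℝ] V →L[ℝ] ℝ) (y₀ : E) (q : E → V) (s : E → ℝ) (z : E) : ℝ :=
  s (y₀ + z) - p₀ (q (y₀ + z)) - P z (q (y₀ + z) - q₀) + P z (Q z) / 2

lemma hasFDerivAt_primitiveCorrection {q₀ : V} {p₀ : V →L[ℝ] ℝ} {Q : E →L[ℝ] V}
    {P : E →L[ℝ] V →L[ℝ] ℝ} {y₀ z : E} {q : E → V} {s : E → ℝ} {q' : E →L[ℝ] V} {s' : E →L[ℝ] ℝ}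
    (hq : HasFDerivAt q q' (y₀ + z)) (hs : HasFDerivAt s s' (y₀ + z)) :
    HasFDerivAt (primitiveCorrection q₀ p₀ Q P y₀ q s)
      (s' - p₀.comp q' - ((P z).comp q' + P.flip (q (y₀ + z) - q₀)) +
        (2⁻¹ : ℝ) • ((P z).comp Q + P.flip (Q z))) z := by
  have ht : HasFDerivAt (fun z : E => y₀ + z) (ContinuousLinearMap.id ℝ E) z :=
    (hasFDerivAt_id z).const_add y₀
  have hq' : HasFDerivAt (fun z => q (y₀ + z)) q' z := by
    simpa using! HasFDerivAt.comp z hq ht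
  have hs' : HasFDerivAt (fun z => s (y₀ + z)) s' z := by
    simpa using! HasFDerivAt.comp z hs ht
  have h1 := (hs'.sub (p₀.hasFDerivAt.comp z hq')).sub
    (P.hasFDerivAt.clm_apply (hq'.sub_const q₀))
  have h2 := (P.hasFDerivAt (x := z)).clm_apply (Q.hasFDerivAt (x := z))
  have h3 := h1.add (h2.const_smul (2⁻¹ : ℝ))
  refine h3.congr_of_eventuallyEq (Eventually.of_forall fun w => ?_)
  simp [primitiveCorrection]; ring

variable {y₀ : E} {r C : ℝ} {Fk : ℕ → E → V × (V →L[ℝ] ℝ)} {sk : ℕ → E → ℝ}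
  {F : E → V × (V →L[ℝ] ℝ)} {s : E → ℝ} {F' : E →L[ℝ] V × (V →L[ℝ] ℝ)}

/-- The limit of the exact approximations satisfies
`h b - h a = A(a, b - a) + o(ε) |b - a|` for `a`, `b` in the ball of radius `ε`, where `h` is
`primitiveCorrection` and `A` is `antisym`. Derivatives of `F_k` enter only through the bound `C`, so
that the estimate survives the limit `k → ∞`. -/
lemma primitiveCorrection_estimate (hr : 0 < r) (hC : 0 ≤ C)
    (hk : ∀ᶠ k in atTop, ∀ y ∈ Metric.ball y₀ r, DifferentiableAt ℝ (Fk k) y ∧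
      ‖fderiv ℝ (Fk k) y‖ ≤ C ∧ HasFDerivAt (sk k)
        ((Fk k y).2.comp ((ContinuousLinearMap.fst ℝ _ _).comp (fderiv ℝ (Fk k) y))) y)
    (hF : TendstoUniformlyOn Fk F atTop (Metric.ball y₀ r))
    (hs : ∀ y ∈ Metric.ball y₀ r, Tendsto (fun k => sk k y) atTop (𝓝 (s y)))
    (hF' : HasFDerivAt F F' y₀) {η : ℝ} (hη : 0 < η) :
    ∃ δ > 0, ∀ ε, 0 < ε → ε < δ → ∀ a b : E, ‖a‖ ≤ ε → ‖b‖ ≤ ε →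
      |primitiveCorrection (F y₀).1 (F y₀).2 ((ContinuousLinearMap.fst ℝ _ _).comp F')
          ((ContinuousLinearMap.snd ℝ _ _).comp F') y₀ (fun y => (F y).1) s b -
        primitiveCorrection (F y₀).1 (F y₀).2 ((ContinuousLinearMap.fst ℝ _ _).comp F')
          ((ContinuousLinearMap.snd ℝ _ _).comp F') y₀ (fun y => (F y).1) s a -
        antisym ((ContinuousLinearMap.fst ℝ _ _).comp F')
          ((ContinuousLinearMap.snd ℝ _ _).comp F') a (b - a)| ≤ η * ε * ‖b - a‖ := by
  set Q := (ContinuousLinearMap.fst ℝ V (V →L[ℝ] ℝ)).comp F' with hQ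
  set P := (ContinuousLinearMap.snd ℝ V (V →L[ℝ] ℝ)).comp F' with hP
  -- the two error terms are bounded by `2 η' ε C |v|` and `2 η' ε ‖P‖ |v|`, whence the choice of `c`
  set c := 2 * (C + ‖P‖) + 1 with hc
  have hc0 : 0 < c := by positivity
  set η' := η / c with hη'
  have hη'0 : 0 < η' := by positivity
  have hlo := (hasFDerivAt_iff_isLittleO_nhds_zero.1 hF').def hη'0
  obtain ⟨δ, hδ, hδF⟩ := Metric.eventually_nhds_iff_ball.1 hlo
  refine ⟨min δ r, lt_min hδ hr, fun ε hε hεδ a b ha hb => ?_⟩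
  have hmem : ∀ z : E, ‖z‖ ≤ ε → y₀ + z ∈ Metric.ball y₀ r := fun z hz => by
    simpa using hz.trans_lt (hεδ.trans_le (min_le_right _ _))
  -- the estimate for the smooth approximations, by the mean value inequality on `[a, b]`
  have key : ∀ᶠ k in atTop,
      |primitiveCorrection (F y₀).1 (F y₀).2 Q P y₀ (fun y => (Fk k y).1) (sk k) b -
        primitiveCorrection (F y₀).1 (F y₀).2 Q P y₀ (fun y => (Fk k y).1) (sk k) a -
        antisym Q P a (b - a)| ≤ η * ε * ‖b - a‖ := by
    filter_upwards [hk, Metric.tendstoUniformlyOn_iff.1 hF (η' * ε) (by positivity)]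
      with k hk hkF
    have hderiv : ∀ z : E, ‖z‖ ≤ ε → ∃ L : E →L[ℝ] ℝ,
        HasFDerivAt (primitiveCorrection (F y₀).1 (F y₀).2 Q P y₀ (fun y => (Fk k y).1) (sk k))
          L z ∧ ∀ v, |L v - antisym Q P z v| ≤ η * ε * ‖v‖ := by
      intro z hz
      obtain ⟨h1, h2, h3⟩ := hk _ (hmem z hz)
      refine ⟨_, hasFDerivAt_primitiveCorrection
        (h1.hasFDerivAt.fst) h3, fun v => ?_⟩
      have hd : ‖Fk k (y₀ + z) - F y₀ - F' z‖ ≤ 2 * η' * ε := by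
        have h4 := hkF _ (hmem z hz)
        rw [dist_comm, dist_eq_norm] at h4
        have h5 := hδF z (by simpa using hz.trans_lt (hεδ.trans_le (min_le_left _ _)))
        calc ‖Fk k (y₀ + z) - F y₀ - F' z‖
            = ‖(Fk k (y₀ + z) - F (y₀ + z)) + (F (y₀ + z) - F y₀ - F' z)‖ := by congr 1; abel
          _ ≤ η' * ε + η' * ‖z‖ := (norm_add_le _ _).trans (add_le_add h4.le h5)
          _ ≤ η' * ε + η' * ε := by gcongr
          _ = 2 * η' * ε := by ring
      have hd1 : ‖(Fk k (y₀ + z)).1 - (F y₀).1 - Q z‖ ≤ 2 * η' * ε :=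
        (norm_fst_le (Fk k (y₀ + z) - F y₀ - F' z)).trans hd
      have hd2 : ‖(Fk k (y₀ + z)).2 - (F y₀).2 - P z‖ ≤ 2 * η' * ε :=
        (norm_snd_le (Fk k (y₀ + z) - F y₀ - F' z)).trans hd
      have hv : ‖(fderiv ℝ (Fk k) (y₀ + z) v).1‖ ≤ C * ‖v‖ :=
        (norm_fst_le _).trans (ContinuousLinearMap.le_of_opNorm_le _ h2 v)
      have e1 : |((Fk k (y₀ + z)).2 - (F y₀).2 - P z) (fderiv ℝ (Fk k) (y₀ + z) v).1| ≤
          2 * η' * ε * (C * ‖v‖) :=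
        (ContinuousLinearMap.le_opNorm _ _).trans (mul_le_mul hd2 hv (norm_nonneg _) (by positivity))
      have e2 : |P v ((Fk k (y₀ + z)).1 - (F y₀).1 - Q z)| ≤ ‖P‖ * ‖v‖ * (2 * η' * ε) :=
        (ContinuousLinearMap.le_opNorm _ _).trans
          (mul_le_mul (P.le_opNorm v) hd1 (norm_nonneg _) (by positivity))
      have e3 : 2 * η' * ε * (C * ‖v‖) + ‖P‖ * ‖v‖ * (2 * η' * ε) ≤ η * ε * ‖v‖ := by
        have : η = c * η' := by rw [hη']; field_simp
        rw [this, hc]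
        have : 0 ≤ η' * ε * ‖v‖ := by positivity
        linarith
      refine le_trans (le_of_eq ?_) ((abs_sub _ _).trans ((add_le_add e1 e2).trans e3))
      congr 1
      simp [antisym]
      ring
    -- along the segment `z = a + t (b - a)`, the value `A(z, b - a)` is constant
    have hseg : ∀ t ∈ Set.Icc (0 : ℝ) 1, ‖a + t • (b - a)‖ ≤ ε := fun t ht => by
      have := (convex_closedBall (0 : E) ε).add_smul_sub_mem (x := a) (y := b)
        (by simpa using ha) (by simpa using hb) ht
      simpa using this
    choose! L hL hLv using hderiv
    have hline : ∀ t : ℝ, HasDerivAt (fun t : ℝ => a + t • (b - a)) (b - a) t := fun t => by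
      simpa using ((hasDerivAt_id t).smul_const (b - a)).const_add a
    have hg : ∀ t ∈ Set.Icc (0 : ℝ) 1, HasDerivWithinAt
        (fun t : ℝ => primitiveCorrection (F y₀).1 (F y₀).2 Q P y₀ (fun y => (Fk k y).1) (sk k)
          (a + t • (b - a)) - t * antisym Q P a (b - a))
        (L (a + t • (b - a)) (b - a) - antisym Q P a (b - a)) (Set.Icc 0 1) t := fun t ht => by
      have h1 := (hL _ (hseg t ht)).comp_hasDerivAt t (hline t)
      have h2 := (hasDerivAt_id t).mul_const (antisym Q P a (b - a))
      simpa using! (h1.sub h2).hasDerivWithinAt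
    have hbound : ∀ t ∈ Set.Icc (0 : ℝ) 1,
        ‖L (a + t • (b - a)) (b - a) - antisym Q P a (b - a)‖ ≤ η * ε * ‖b - a‖ := fun t ht => by
      have h1 := hLv _ (hseg t ht) (b - a)
      have h2 : antisym Q P (a + t • (b - a)) (b - a) = antisym Q P a (b - a) := by
        simp [antisym]
        ring
      rwa [h2] at h1
    have := (convex_Icc (0 : ℝ) 1).norm_image_sub_le_of_norm_hasDerivWithin_le hg hbound
      (Set.left_mem_Icc.2 zero_le_one) (Set.right_mem_Icc.2 zero_le_one)
    simp only [one_smul, zero_smul, add_sub_cancel, add_zero, one_mul, zero_mul, sub_zero,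
      norm_one, mul_one, Real.norm_eq_abs] at this
    rwa [sub_right_comm] at this
  have hlim : ∀ z : E, ‖z‖ ≤ ε → Tendsto (fun k =>
      primitiveCorrection (F y₀).1 (F y₀).2 Q P y₀ (fun y => (Fk k y).1) (sk k) z) atTop
      (𝓝 (primitiveCorrection (F y₀).1 (F y₀).2 Q P y₀ (fun y => (F y).1) s z)) := fun z hz => by
    have h1 := hs _ (hmem z hz)
    have h2 : Tendsto (fun k => (Fk k (y₀ + z)).1) atTop (𝓝 (F (y₀ + z)).1) :=
      (hF.tendsto_at (hmem z hz)).fst_nhds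
    exact ((h1.sub (((F y₀).2.continuous.tendsto _).comp h2)).sub
      (((P z).continuous.tendsto _).comp (h2.sub_const _))).add_const _
  exact le_of_tendsto (((hlim b hb).sub (hlim a ha)).sub_const _).abs key

/-- If smooth maps `F_k = (q_k, p_k)` with bounded derivatives and functions `s_k` with `ds_k = p_k dq_k`
converge to `F = (q, p)` and `s`, then at any common point of differentiability `ds = p dq`, and the
derivative of `F` is isotropic for `dp ∧ dq`. -/
theorem limit_of_exact_approximations (hr : 0 < r) (hC : 0 ≤ C)
    (hk : ∀ᶠ k in atTop, ∀ y ∈ Metric.ball y₀ r, DifferentiableAt ℝ (Fk k) y ∧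
      ‖fderiv ℝ (Fk k) y‖ ≤ C ∧ HasFDerivAt (sk k)
        ((Fk k y).2.comp ((ContinuousLinearMap.fst ℝ _ _).comp (fderiv ℝ (Fk k) y))) y)
    (hF : TendstoUniformlyOn Fk F atTop (Metric.ball y₀ r))
    (hs : ∀ y ∈ Metric.ball y₀ r, Tendsto (fun k => sk k y) atTop (𝓝 (s y)))
    (hF' : HasFDerivAt F F' y₀) {s' : E →L[ℝ] ℝ} (hs' : HasFDerivAt s s' y₀) :
    (∀ v, s' v = (F y₀).2 (F' v).1) ∧ ∀ u w, (F' u).2 (F' w).1 = (F' w).2 (F' u).1 := by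
  have est := fun {η : ℝ} (hη : 0 < η) => primitiveCorrection_estimate hr hC hk hF hs hF' hη
  set Q := (ContinuousLinearMap.fst ℝ V (V →L[ℝ] ℝ)).comp F' with hQ
  set P := (ContinuousLinearMap.snd ℝ V (V →L[ℝ] ℝ)).comp F' with hP
  set f := primitiveCorrection (F y₀).1 (F y₀).2 Q P y₀ (fun y => (F y).1) s with hf
  constructor
  -- the estimate with `a = 0` and `ε = |b|` shows that `f` has derivative zero at the origin
  · have h0 : HasFDerivAt f (0 : E →L[ℝ] ℝ) 0 := by
      rw [hasFDerivAt_iff_isLittleO_nhds_zero, Asymptotics.isLittleO_iff]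
      intro η hη
      obtain ⟨δ, hδ, h⟩ := est hη
      filter_upwards [Metric.ball_mem_nhds (0 : E) (lt_min hδ one_pos)] with z hz
      rcases eq_or_ne z 0 with rfl | hz0
      · simp
      have hz' : ‖z‖ < min δ 1 := by simpa using hz
      have h1 := h ‖z‖ (norm_pos_iff.2 hz0) (hz'.trans_le (min_le_left _ _)) 0 z (by simp) le_rfl
      have h2 : antisym Q P 0 z = 0 := by simp [antisym]
      rw [sub_zero, h2, sub_zero] at h1
      rw [zero_add, _root_.zero_apply, sub_zero]
      refine h1.trans ?_
      have : η * ‖z‖ ≤ η * 1 := by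
        gcongr
        exact hz'.le.trans (min_le_right _ _)
      calc η * ‖z‖ * ‖z‖ ≤ η * 1 * ‖z‖ := by gcongr
        _ = η * ‖z‖ := by ring
    have h1 := hasFDerivAt_primitiveCorrection (q₀ := (F y₀).1) (p₀ := (F y₀).2) (Q := Q) (P := P)
      (z := 0) (by simpa using! hF'.fst : HasFDerivAt (fun y => (F y).1) Q (y₀ + 0))
      (by simpa using hs')
    intro v
    have h2 := congrArg (fun L : E →L[ℝ] ℝ => L v) (h0.unique h1)
    simp at h2
    have h3 : (F y₀).2 (Q v) = (F y₀).2 (F' v).1 := rfl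
    linarith
  · intro u w
    set m := ‖u‖ + ‖w‖ + 1 with hm
    have hm0 : 0 < m := by positivity
    -- sum the estimate over the sides of the triangle with vertices `0`, `τ u`, `τ w`
    have hA : |antisym Q P u w| ≤ 0 := by
      refine le_of_forall_pos_le_add fun η hη => ?_
      obtain ⟨δ, hδ, h⟩ := est (show 0 < η / (4 * m ^ 2) by positivity)
      set ε := δ / 2 with hε
      have hε0 : 0 < ε := by positivity
      have h := h ε hε0 (by linarith)
      set τ := ε / m with hτ
      have hτ0 : 0 < τ := by positivity
      have hτm : ε = τ * m := by rw [hτ]; field_simp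
      have hu : ‖τ • u‖ = τ * ‖u‖ := by rw [norm_smul, Real.norm_of_nonneg hτ0.le]
      have hw : ‖τ • w‖ = τ * ‖w‖ := by rw [norm_smul, Real.norm_of_nonneg hτ0.le]
      have nu := norm_nonneg u
      have nw := norm_nonneg w
      have hu' : ‖τ • u‖ ≤ ε := by
        rw [hu, hτm]; gcongr; linarith
      have hw' : ‖τ • w‖ ≤ ε := by
        rw [hw, hτm]; gcongr; linarith
      have h1 := h 0 (τ • u) (by simpa using hε0.le) hu'
      have h2 := h (τ • u) (τ • w) hu' hw'
      have h3 := h (τ • w) 0 hw' (by simpa using hε0.le)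
      have b1 : ‖τ • u - 0‖ ≤ ε := by simpa using hu'
      have b2 : ‖τ • w - τ • u‖ ≤ 2 * ε := (norm_sub_le _ _).trans (by linarith)
      have b3 : ‖0 - τ • w‖ ≤ ε := by simpa using hw'
      have c0 : 0 ≤ η / (4 * m ^ 2) * ε := by positivity
      replace h1 := h1.trans (mul_le_mul_of_nonneg_left b1 c0)
      replace h2 := h2.trans (mul_le_mul_of_nonneg_left b2 c0)
      replace h3 := h3.trans (mul_le_mul_of_nonneg_left b3 c0)
      have a1 : antisym Q P 0 (τ • u - 0) = 0 := by simp [antisym]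
      have a2 : antisym Q P (τ • u) (τ • w - τ • u) = τ ^ 2 * antisym Q P u w := by
        simp [antisym]; ring
      have a3 : antisym Q P (τ • w) (0 - τ • w) = 0 := by simp [antisym]
      rw [a1] at h1
      rw [a2] at h2
      rw [a3] at h3
      have h4 : |τ ^ 2 * antisym Q P u w| ≤ τ ^ 2 * η := by
        have e : η / (4 * m ^ 2) * ε * ε + η / (4 * m ^ 2) * ε * (2 * ε) +
            η / (4 * m ^ 2) * ε * ε = τ ^ 2 * η := by
          rw [hτ]; field_simp; ring
        rw [abs_le] at h1 h2 h3 ⊢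
        constructor <;> linarith [h1.1, h1.2, h2.1, h2.2, h3.1, h3.2]
      rw [abs_mul, abs_of_pos (by positivity : 0 < τ ^ 2)] at h4
      simpa using le_of_mul_le_mul_left h4 (by positivity)
    have h1 := abs_eq_zero.1 (le_antisymm hA (abs_nonneg _))
    have h2 : antisym Q P u w = ((F' u).2 (F' w).1 - (F' w).2 (F' u).1) / 2 := rfl
    linarith

end Analytic

/-! ### Comparison of the Riemannian distance with charts -/

section LowerBound

open Manifold Set

variable {E : Type*} [NormedAddCommGroup E] [NormedSpace ℝ E]
  {H : Type*} [TopologicalSpace H] {I : ModelWithCorners ℝ E H}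
  {M : Type*} [TopologicalSpace M] [ChartedSpace H M]
  [RiemannianBundle (fun x : M => TangentSpace I x)]
  [IsManifold I 1 M] [IsContinuousRiemannianBundle E (fun x : M => TangentSpace I x)]

omit [IsContinuousRiemannianBundle E fun x : M => TangentSpace I x] in
/-- A `C¹` path staying where the derivative of the chart is bounded by `C` is lengthened by at most
the factor `C` in the chart. -/
lemma edist_extChartAt_le_pathELength (x : M) {C : ℝ≥0} {u : Set M}
    (hu : u ⊆ (chartAt H x).source)
    (hC : ∀ y ∈ u, ∀ w : TangentSpace I y,
      ‖(trivializationAt E (TangentSpace I) x).continuousLinearMapAt ℝ y w‖ₑ ≤ C * ‖w‖ₑ)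
    {γ : ℝ → M} (hγ : ContMDiff 𝓘(ℝ, ℝ) I 1 γ) (hγu : ∀ t ∈ Icc (0 : ℝ) 1, γ t ∈ u) :
    edist (extChartAt I x (γ 0)) (extChartAt I x (γ 1)) ≤ C * pathELength I γ 0 1 := by
  let γ' := extChartAt I x ∘ γ
  have hC' : ContMDiffOn 𝓘(ℝ, ℝ) 𝓘(ℝ, E) 1 γ' (Icc 0 1) :=
    contMDiffOn_extChartAt.comp (I' := I) (t := (chartAt H x).source)
      hγ.contMDiffOn (fun t' ht' ↦ hu <| hγu t' ht')
  have hderiv : ∀ t ∈ Icc (0 : ℝ) 1, derivWithin γ' (Icc 0 1) t =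
      (trivializationAt E (TangentSpace I) x).continuousLinearMapAt ℝ (γ t)
        (mfderiv[Icc (0 : ℝ) 1] γ t 1) := by
    intro t ht
    have hs := hu (hγu t ht)
    have h1 := (mdifferentiableAt_extChartAt (I := I) hs).hasMFDerivAt.comp_hasMFDerivWithinAt t
      ((hγ.mdifferentiable one_ne_zero).mdifferentiableOn (s := Icc (0 : ℝ) 1) t
        ht).hasMFDerivWithinAt
    have h2 : HasFDerivWithinAt γ' (_ : ℝ →L[ℝ] E) (Icc 0 1) t := h1.hasFDerivWithinAt
    rw [h2.hasDerivWithinAt.derivWithin (uniqueDiffOn_Icc zero_lt_one t ht),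
      TangentBundle.continuousLinearMapAt_trivializationAt hs]
    rfl
  calc
    edist (γ' 0) (γ' 1) = ‖γ' 1 - γ' 0‖ₑ := by rw [edist_comm, edist_eq_enorm_sub]
    _ ≤ ∫⁻ t' in Icc 0 1, ‖derivWithin γ' (Icc 0 1) t'‖ₑ := by
      apply enorm_sub_le_lintegral_derivWithin_Icc_of_contDiffOn_Icc _ zero_le_one
      rwa [← contMDiffOn_iff_contDiffOn]
    _ ≤ ∫⁻ t' in Icc 0 1, C * ‖mfderiv[Icc (0 : ℝ) 1] γ t' 1‖ₑ := by
      refine setLIntegral_mono' measurableSet_Icc fun t' ht' ↦ ?_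
      rw [hderiv t' ht']
      exact hC _ (hγu t' ht') _
    _ = C * pathELength I γ 0 1 := by
      rw [lintegral_const_mul' _ _ ENNReal.coe_ne_top,
          pathELength_eq_lintegral_mfderivWithin_Icc]

/-- Near `x`, distances in the chart at `x` are bounded by a multiple of the Riemannian distance. Both
points are allowed to vary, and the neighborhood is a Riemannian ball. -/
theorem exists_edist_extChartAt_le_riemannianEDist [RegularSpace M] (x : M) :
    ∃ C : ℝ≥0, ∃ c : ℝ≥0, 0 < c ∧
      (∀ y, riemannianEDist I x y < c → y ∈ (chartAt H x).source) ∧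
      ∀ y z, riemannianEDist I x y < c → riemannianEDist I x z < c →
        edist (extChartAt I x y) (extChartAt I x z) ≤ C * riemannianEDist I y z := by
  obtain ⟨C, hC0, hC⟩ := eventually_norm_trivializationAt_lt E (fun x : M => TangentSpace I x) x
  lift C to ℝ≥0 using hC0.le
  rcases setOfPred_riemannianEDist_lt_subset_nhds I
    (inter_mem hC (chart_source_mem_nhds H x)) with ⟨c, c_pos, hc⟩
  refine ⟨C, c / 4, by positivity, fun y hy => (hc (show riemannianEDist I x y < c from
    hy.trans_le ?_)).2, fun y z hy hz => ?_⟩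
  · norm_cast
    rw [← NNReal.coe_le_coe]
    push_cast
    linarith [c.coe_nonneg]
  have hc4 : ((c / 4 : ℝ≥0) : ℝ≥0∞) + (c / 4 : ℝ≥0) = (c / 2 : ℝ≥0) := by
    rw [← ENNReal.coe_add]; congr 1; ext; push_cast; ring
  have hc2 : ((c / 4 : ℝ≥0) : ℝ≥0∞) + (c / 2 : ℝ≥0) ≤ c := by
    rw [← ENNReal.coe_add]; norm_cast; rw [← NNReal.coe_le_coe]; push_cast
    linarith [c.coe_nonneg]
  have hyz : riemannianEDist I y z < (c / 2 : ℝ≥0) := by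
    rw [← hc4]
    refine (riemannianEDist_triangle (y := x)).trans_lt ?_
    rw [riemannianEDist_comm (x := y)]
    exact ENNReal.add_lt_add hy hz
  -- a nearly minimizing path from `y` to `z` stays in the ball of radius `c` around `x`
  have main : ∀ ρ, riemannianEDist I y z < ρ → ρ < (c / 2 : ℝ≥0) →
      edist (extChartAt I x y) (extChartAt I x z) ≤ C * ρ := by
    intro ρ h1 h2
    obtain ⟨γ, γ0, γ1, hγ, hl, -⟩ := exists_lt_locally_constant_of_riemannianEDist_lt h1 zero_lt_one
    have hmem : ∀ t ∈ Icc (0 : ℝ) 1, riemannianEDist I x (γ t) < c := fun t ht => by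
      have h3 : riemannianEDist I y (γ t) ≤ pathELength I γ 0 1 :=
        (riemannianEDist_le_pathELength hγ.contMDiffOn γ0 rfl ht.1).trans
          (pathELength_mono le_rfl ht.2)
      calc riemannianEDist I x (γ t) ≤ riemannianEDist I x y + riemannianEDist I y (γ t) :=
            riemannianEDist_triangle
        _ < (c / 4 : ℝ≥0) + (c / 2 : ℝ≥0) := ENNReal.add_lt_add hy ((h3.trans_lt hl).trans h2)
        _ ≤ c := hc2
    have := edist_extChartAt_le_pathELength x (C := C) (u := {y | riemannianEDist I x y < c})
      (fun y hy => (hc hy).2) (fun y hy w => by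
        have := ContinuousLinearMap.le_of_opNorm_le _ (hc hy).1.le w
        simp only [enorm]
        exact_mod_cast this) hγ hmem
    rw [γ0, γ1] at this
    exact this.trans (by gcongr)
  obtain ⟨u, -, hu, hut⟩ := exists_seq_strictAnti_tendsto' hyz
  refine ge_of_tendsto (ENNReal.Tendsto.const_mul hut (Or.inr ENNReal.coe_ne_top)) ?_
  exact Eventually.of_forall fun k => main (u k) (hu k).1 (hu k).2

end LowerBound

section UpperBound

open Manifold Set

variable {E : Type*} [NormedAddCommGroup E] [NormedSpace ℝ E]
  {N : Type*} [TopologicalSpace N] [ChartedSpace E N]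
  [RiemannianBundle (fun x : N => TangentSpace 𝓘(ℝ, E) x)]
  [IsManifold 𝓘(ℝ, E) ∞ N]
  {e : OpenPartialHomeomorph N E}

omit [IsManifold 𝓘(ℝ, E) ∞ N] in
/-- The Riemannian distance between two points of a chart is at most the length of the segment joining
them in the chart. -/
lemma riemannianEDist_symm_le (he : e ∈ IsManifold.maximalAtlas 𝓘(ℝ, E) ∞ N) {y y' : E}
    (hseg : segment ℝ y y' ⊆ e.target) {c : ℝ≥0∞}
    (h : ∀ z ∈ segment ℝ y y', ‖mfderiv 𝓘(ℝ, E) 𝓘(ℝ, E) e.symm z (y' - y)‖ₑ ≤ c) :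
    riemannianEDist 𝓘(ℝ, E) (e.symm y) (e.symm y') ≤ c := by
  have hsymm := contMDiffOn_symm_of_mem_maximalAtlas he
  have hline : ContDiff ℝ 1 (fun t : ℝ => y + t • (y' - y)) := by fun_prop
  have hmem : ∀ t ∈ Icc (0 : ℝ) 1, y + t • (y' - y) ∈ segment ℝ y y' := fun t ht => by
    rw [segment_eq_image']
    exact ⟨t, ht, rfl⟩
  have hγ : ContMDiffOn 𝓘(ℝ, ℝ) 𝓘(ℝ, E) 1 (fun t : ℝ => e.symm (y + t • (y' - y))) (Icc 0 1) :=
    (hsymm.of_le (by norm_cast)).comp hline.contMDiff.contMDiffOn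
      fun t ht => hseg (hmem t ht)
  refine (riemannianEDist_le_pathELength hγ (by simp) (by simp) zero_le_one).trans ?_
  rw [pathELength_eq_lintegral_mfderiv_Icc]
  have : ∀ t ∈ Icc (0 : ℝ) 1,
      ‖mfderiv 𝓘(ℝ, ℝ) 𝓘(ℝ, E) (fun t : ℝ => e.symm (y + t • (y' - y))) t 1‖ₑ ≤ c := by
    intro t ht
    have h1 : MDifferentiableAt 𝓘(ℝ, E) 𝓘(ℝ, E) e.symm (y + t • (y' - y)) :=
      ((hsymm _ (hseg (hmem t ht))).mdifferentiableWithinAt (by simp)).mdifferentiableAt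
        (e.open_target.mem_nhds (hseg (hmem t ht)))
    have h2 : HasMFDerivAt 𝓘(ℝ, ℝ) 𝓘(ℝ, E) (fun t : ℝ => y + t • (y' - y)) t
        (ContinuousLinearMap.toSpanSingleton ℝ (y' - y)) := by
      refine HasFDerivAt.hasMFDerivAt ?_
      have := (((hasDerivAt_id t).smul_const (y' - y)).const_add y).hasFDerivAt
      rwa [one_smul] at this
    have h3 := (h1.hasMFDerivAt.comp t h2).mfderiv
    have h4 : mfderiv 𝓘(ℝ, ℝ) 𝓘(ℝ, E) (fun t : ℝ => e.symm (y + t • (y' - y))) t 1 =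
        mfderiv 𝓘(ℝ, E) 𝓘(ℝ, E) e.symm (y + t • (y' - y)) (y' - y) := by
      refine (congrArg (fun L => L 1) h3).trans ?_
      change mfderiv 𝓘(ℝ, E) 𝓘(ℝ, E) e.symm (y + t • (y' - y)) ((1 : ℝ) • (y' - y)) = _
      rw [one_smul]
    rw [h4]
    exact h _ (hmem t ht)
  calc _ ≤ ∫⁻ _ in Icc (0 : ℝ) 1, c := setLIntegral_mono' measurableSet_Icc this
    _ = c := by simp

omit [IsManifold 𝓘(ℝ, E) ∞ N] in
lemma norm_mfderiv_symm_smul (y : E) (t : ℝ) (w : E) :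
    ‖mfderiv 𝓘(ℝ, E) 𝓘(ℝ, E) e.symm y (t • w : E)‖ =
      |t| * ‖mfderiv 𝓘(ℝ, E) 𝓘(ℝ, E) e.symm y w‖ := by
  have h : mfderiv 𝓘(ℝ, E) 𝓘(ℝ, E) e.symm y (t • w : E) =
      t • mfderiv 𝓘(ℝ, E) 𝓘(ℝ, E) e.symm y w :=
    (mfderiv 𝓘(ℝ, E) 𝓘(ℝ, E) e.symm y).map_smul t w
  rw [h, norm_smul, Real.norm_eq_abs]

variable [IsContinuousRiemannianBundle E (fun x : N => TangentSpace 𝓘(ℝ, E) x)]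

lemma continuousOn_norm_mfderiv_symm (he : e ∈ IsManifold.maximalAtlas 𝓘(ℝ, E) ∞ N) :
    ContinuousOn (fun p : E × E => ‖mfderiv 𝓘(ℝ, E) 𝓘(ℝ, E) e.symm p.1 p.2‖)
      (e.target ×ˢ univ) := by
  have hsymm := contMDiffOn_symm_of_mem_maximalAtlas he
  have h1 := hsymm.continuousOn_tangentMapWithin (by simp) e.open_target.uniqueMDiffOn
  have h2 : ContinuousOn (fun p : E × E => tangentMapWithin 𝓘(ℝ, E) 𝓘(ℝ, E) e.symm e.target
      ((tangentBundleModelSpaceHomeomorph 𝓘(ℝ, E)).symm p)) (e.target ×ˢ univ) :=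
    h1.comp (tangentBundleModelSpaceHomeomorph 𝓘(ℝ, E)).symm.continuous.continuousOn
      fun p hp => hp.1
  have h3 : ContinuousOn (fun p : E × E => (⟨e.symm p.1, mfderiv 𝓘(ℝ, E) 𝓘(ℝ, E) e.symm p.1 p.2⟩ :
      TotalSpace E (fun x : N => TangentSpace 𝓘(ℝ, E) x))) (e.target ×ˢ univ) := by
    refine h2.congr fun p hp => ?_
    have : mfderivWithin 𝓘(ℝ, E) 𝓘(ℝ, E) e.symm e.target p.1 =
        mfderiv 𝓘(ℝ, E) 𝓘(ℝ, E) e.symm p.1 := mfderivWithin_of_mem_nhds (e.open_target.mem_nhds hp.1)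
    change _ = (⟨e.symm p.1, mfderivWithin 𝓘(ℝ, E) 𝓘(ℝ, E) e.symm e.target p.1 p.2⟩ :
      TotalSpace E (fun x : N => TangentSpace 𝓘(ℝ, E) x))
    rw [this]
  have h4 := (h3.inner_bundle h3).sqrt
  refine h4.congr fun p hp => ?_
  exact norm_eq_sqrt_real_inner _

lemma exists_riemannianEDist_symm_le (he : e ∈ IsManifold.maximalAtlas 𝓘(ℝ, E) ∞ N) {y₀ : E}
    (hy₀ : y₀ ∈ e.target) :
    ∃ C : ℝ≥0, ∃ r > 0, Metric.ball y₀ r ⊆ e.target ∧ ∀ y ∈ Metric.ball y₀ r,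
      ∀ y' ∈ Metric.ball y₀ r,
        riemannianEDist 𝓘(ℝ, E) (e.symm y) (e.symm y') ≤ C * edist y y' := by
  have hc := (continuousOn_norm_mfderiv_symm he).continuousAt (x := (y₀, 0))
    ((e.open_target.prod isOpen_univ).mem_nhds ⟨hy₀, mem_univ _⟩)
  have h1 : ∀ᶠ p : E × E in 𝓝 (y₀, 0), ‖mfderiv 𝓘(ℝ, E) 𝓘(ℝ, E) e.symm p.1 p.2‖ < 1 := by
    refine hc.eventually (gt_mem_nhds ?_)
    have h0 := norm_mfderiv_symm_smul (e := e) y₀ 0 0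
    rw [smul_zero, abs_zero, zero_mul] at h0
    exact h0.trans_lt one_pos
  have h2 : ∀ᶠ p : E × E in 𝓝 (y₀, 0), p.1 ∈ e.target :=
    continuousAt_fst.eventually (e.open_target.mem_nhds hy₀)
  obtain ⟨δ, hδ, h3⟩ := Metric.eventually_nhds_iff_ball.1 (h1.and h2)
  have hball : Metric.ball y₀ δ ⊆ e.target := fun y hy =>
    (h3 (y, 0) (by simpa [Prod.dist_eq, hδ] using hy)).2
  refine ⟨⟨2 / δ, by positivity⟩, δ, hδ, hball, fun y hy y' hy' => ?_⟩
  have hseg : segment ℝ y y' ⊆ Metric.ball y₀ δ := (convex_ball y₀ δ).segment_subset hy hy'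
  refine riemannianEDist_symm_le he (hseg.trans hball) fun z hz => ?_
  have hz' := hseg hz
  rcases eq_or_ne y' y with rfl | hne
  · have h0 := norm_mfderiv_symm_smul (e := e) z 0 0
    rw [smul_zero, abs_zero, zero_mul] at h0
    rw [sub_self, ← ofReal_norm, h0]
    simp
  -- by homogeneity it suffices to consider vectors of norm `δ / 2`
  set v := y' - y with hv
  have hv0 : 0 < ‖v‖ := norm_pos_iff.2 (sub_ne_zero.2 hne)
  have h4 := (h3 (z, (δ / (2 * ‖v‖)) • v) (by
    rw [← ball_prod_same]
    refine ⟨hz', ?_⟩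
    rw [mem_ball_zero_iff, norm_smul, Real.norm_of_nonneg (by positivity)]
    have : δ / (2 * ‖v‖) * ‖v‖ = δ / 2 := by field_simp
    linarith)).1
  rw [norm_mfderiv_symm_smul, abs_of_nonneg (by positivity)] at h4
  have h5 : ‖mfderiv 𝓘(ℝ, E) 𝓘(ℝ, E) e.symm z v‖ ≤ 2 / δ * ‖v‖ := by
    have h6 : 0 < 2 * ‖v‖ / δ := by positivity
    have h7 := mul_lt_mul_of_pos_left h4 h6
    have h8 : 2 * ‖v‖ / δ * (δ / (2 * ‖v‖) * ‖mfderiv 𝓘(ℝ, E) 𝓘(ℝ, E) e.symm z v‖) =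
        ‖mfderiv 𝓘(ℝ, E) 𝓘(ℝ, E) e.symm z v‖ := by field_simp
    rw [h8] at h7
    exact h7.le.trans (le_of_eq (by ring))
  have h6 : edist y y' = ENNReal.ofReal ‖v‖ := by
    rw [edist_comm, edist_eq_enorm_sub, ofReal_norm]
  rw [← ofReal_norm, h6]
  refine (ENNReal.ofReal_le_ofReal h5).trans (le_of_eq ?_)
  rw [ENNReal.ofReal_mul (by positivity)]
  congr 1
  exact ENNReal.ofReal_eq_coe_nnreal (by positivity)

/-- The differential of a function which is `K`-Lipschitz for the Riemannian distance is bounded by the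
same constant `K`, so that the bound is uniform on the manifold. -/
lemma abs_fderiv_le_of_lipschitz (he : e ∈ IsManifold.maximalAtlas 𝓘(ℝ, E) ∞ N) {y₀ : E}
    (hy₀ : y₀ ∈ e.target) {S : N → ℝ} {K : ℝ≥0}
    (hS : ∀ x y, edist (S x) (S y) ≤ K * riemannianEDist 𝓘(ℝ, E) x y) {s' : E →L[ℝ] ℝ}
    (hs' : HasFDerivAt (S ∘ e.symm) s' y₀) (w : E) :
    |s' w| ≤ K * ‖mfderiv 𝓘(ℝ, E) 𝓘(ℝ, E) e.symm y₀ w‖ := by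
  set ℓ := ‖mfderiv 𝓘(ℝ, E) 𝓘(ℝ, E) e.symm y₀ w‖ with hℓ
  have hmain : ∀ η > 0, |s' w| ≤ K * (ℓ + η) := by
    intro η hη
    have hline : HasDerivAt (fun t : ℝ => y₀ + t • w) w 0 := by
      simpa using ((hasDerivAt_id (0 : ℝ)).smul_const w).const_add y₀
    have hd : HasDerivAt (fun t : ℝ => (S ∘ e.symm) (y₀ + t • w)) (s' w) 0 :=
      HasFDerivAt.comp_hasDerivAt (0 : ℝ) (by simpa using hs') hline
    have hc := (continuousOn_norm_mfderiv_symm he).continuousAt (x := (y₀, w))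
      ((e.open_target.prod isOpen_univ).mem_nhds ⟨hy₀, mem_univ _⟩)
    have h1 : ∀ᶠ z in 𝓝 y₀, ‖mfderiv 𝓘(ℝ, E) 𝓘(ℝ, E) e.symm z w‖ < ℓ + η ∧ z ∈ e.target := by
      have h2 : ContinuousAt (fun z : E => (z, w)) y₀ := by fun_prop
      have h3 := ContinuousAt.comp (f := fun z : E => (z, w)) hc h2
      exact (h3.eventually (gt_mem_nhds (show _ < ℓ + η by simp [hℓ, hη]))).and
        (e.open_target.mem_nhds hy₀)
    obtain ⟨δ, hδ, h4⟩ := Metric.eventually_nhds_iff_ball.1 h1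
    have h5 : ∀ᶠ t : ℝ in 𝓝 0, y₀ + t • w ∈ Metric.ball y₀ δ :=
      hline.continuousAt (Metric.isOpen_ball.mem_nhds (by simpa using hδ))
    have h6 : ∀ᶠ t : ℝ in 𝓝 0, ‖(S ∘ e.symm) (y₀ + t • w) - (S ∘ e.symm) (y₀ + (0 : ℝ) • w)‖ ≤
        K * (ℓ + η) * ‖t - 0‖ := by
      filter_upwards [h5] with t ht
      have hseg : segment ℝ y₀ (y₀ + t • w) ⊆ Metric.ball y₀ δ :=
        (convex_ball y₀ δ).segment_subset (Metric.mem_ball_self hδ) ht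
      have h7 := riemannianEDist_symm_le he (fun z hz => (h4 z (hseg hz)).2)
        (c := ENNReal.ofReal ((ℓ + η) * |t|)) (fun z hz => by
          rw [add_sub_cancel_left, ← ofReal_norm, norm_mfderiv_symm_smul, mul_comm]
          exact ENNReal.ofReal_le_ofReal
            (mul_le_mul_of_nonneg_right (h4 z (hseg hz)).1.le (abs_nonneg t)))
      have h8 := (hS _ _).trans (mul_le_mul_right h7 (K : ℝ≥0∞))
      rw [edist_comm, edist_dist, Real.dist_eq, ← ENNReal.ofReal_coe_nnreal,
        ← ENNReal.ofReal_mul K.coe_nonneg, ENNReal.ofReal_le_ofReal_iff (by positivity)] at h8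
      simpa [mul_assoc] using! h8
    have h9 := hd.hasFDerivAt.le_of_lip' (by positivity) h6
    have h10 := ContinuousLinearMap.le_of_opNorm_le _ h9 1
    simpa using h10
  have : Tendsto (fun η : ℝ => K * (ℓ + η)) (𝓝[>] 0) (𝓝 (K * (ℓ + 0))) :=
    (Continuous.tendsto (by fun_prop) 0).mono_left nhdsWithin_le_nhds
  rw [add_zero] at this
  exact ge_of_tendsto this (eventually_mem_nhdsWithin.mono fun η hη => hmain η hη)

end UpperBound

/-! ### The Liouville form and its differential in charts of the cotangent bundle -/

section Bundle

lemma t2Space_totalSpace {B F : Type*} {E : B → Type*} [TopologicalSpace B] [TopologicalSpace F]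
    [TopologicalSpace (TotalSpace F E)] [∀ b, TopologicalSpace (E b)] [FiberBundle F E]
    [T2Space B] [T2Space F] : T2Space (TotalSpace F E) := by
  refine ⟨fun x y hxy => ?_⟩
  by_cases h : x.proj = y.proj
  · set t := trivializationAt F E x.proj
    have hx : x ∈ t.source := FiberBundle.mem_trivializationAt_proj_source
    have hy : y ∈ t.source := by
      rw [t.mem_source, ← h]; exact FiberBundle.mem_baseSet_trivializationAt' _
    have hne : t x ≠ t y := fun he => hxy (t.injOn hx hy he)
    obtain ⟨u, v, hu, hv, hxu, hyv, huv⟩ := t2_separation hne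
    exact ⟨t.source ∩ t ⁻¹' u, t.source ∩ t ⁻¹' v, t.isOpen_inter_preimage hu,
      t.isOpen_inter_preimage hv, ⟨hx, hxu⟩, ⟨hy, hyv⟩,
      (huv.preimage t).mono Set.inter_subset_right Set.inter_subset_right⟩
  · obtain ⟨u, v, hu, hv, hxu, hyv, huv⟩ := t2_separation h
    exact ⟨_, _, hu.preimage (FiberBundle.continuous_proj F E),
      hv.preimage (FiberBundle.continuous_proj F E), hxu, hyv, huv.preimage _⟩

lemma differentiableAt_ofSubsingleton {W : Type*} [NormedAddCommGroup W] [NormedSpace ℝ W]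
    {f : W → W →L[ℝ] ℝ} {y : W} (hf : DifferentiableAt ℝ f y) :
    DifferentiableAt ℝ
      (fun y => ContinuousAlternatingMap.ofSubsingleton ℝ W ℝ (0 : Fin 1) (f y)) y :=
  (ContinuousAlternatingMap.ofSubsingletonLIE (𝕜 := ℝ) (E := W) (F := ℝ)
    (i := (0 : Fin 1))).differentiableAt.comp y hf

/-- The exterior derivative of the tautological one-form `(q, p) ↦ p ∘ dq` on `V × V*`. -/
lemma extDeriv_eq_of_eventuallyEq_tautological {V : Type*} [NormedAddCommGroup V] [NormedSpace ℝ V]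
    {α : V × (V →L[ℝ] ℝ) → V × (V →L[ℝ] ℝ) →L[ℝ] ℝ} {y : V × (V →L[ℝ] ℝ)}
    (hα : ∀ᶠ y' in 𝓝 y, α y' = y'.2.comp (ContinuousLinearMap.fst ℝ V (V →L[ℝ] ℝ)))
    (v : Fin 2 → V × (V →L[ℝ] ℝ)) :
    _root_.extDeriv (fun y' => ContinuousAlternatingMap.ofSubsingleton ℝ
        (V × (V →L[ℝ] ℝ)) ℝ (0 : Fin 1) (α y')) y v =
      (v 0).2 (v 1).1 - (v 1).2 (v 0).1 := by
  have hev : (fun y' => ContinuousAlternatingMap.ofSubsingleton ℝ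
        (V × (V →L[ℝ] ℝ)) ℝ (0 : Fin 1) (α y')) =ᶠ[𝓝 y]
      fun y' => ContinuousAlternatingMap.ofSubsingleton ℝ (V × (V →L[ℝ] ℝ)) ℝ (0 : Fin 1)
        (y'.2.comp (ContinuousLinearMap.fst ℝ V (V →L[ℝ] ℝ))) := by
    filter_upwards [hα] with y' hy'
    rw [hy']
  rw [hev.extDeriv_eq]
  have hd : DifferentiableAt ℝ (fun y : V × (V →L[ℝ] ℝ) => ContinuousAlternatingMap.ofSubsingleton ℝ
      (V × (V →L[ℝ] ℝ)) ℝ (0 : Fin 1) (y.2.comp (ContinuousLinearMap.fst ℝ V (V →L[ℝ] ℝ)))) y := by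
    have h1 : DifferentiableAt ℝ (fun y : V × (V →L[ℝ] ℝ) =>
        y.2.comp (ContinuousLinearMap.fst ℝ V (V →L[ℝ] ℝ))) y :=
      differentiableAt_snd.clm_comp (differentiableAt_const _)
    exact differentiableAt_ofSubsingleton h1
  have hf : ∀ a b : V × (V →L[ℝ] ℝ), fderiv ℝ (fun y : V × (V →L[ℝ] ℝ) => y.2 a.1) y b = b.2 a.1 :=
    fun a b => by
      have h : HasFDerivAt (fun y : V × (V →L[ℝ] ℝ) => y.2 a.1) _ y :=
        hasFDerivAt_snd.clm_apply (hasFDerivAt_const a.1 y)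
      rw [h.fderiv]
      simp
  rw [extDeriv_apply hd, Fin.sum_univ_two]
  simp [Fin.removeNth, Fin.tail, hf]
  ring

variable {n : ℕ} {M : Type*} [TopologicalSpace M]
  [ChartedSpace (EuclideanSpace ℝ (Fin n)) M] [IsManifold (𝓡 n) ∞ M]

lemma regularSpace_cotangent [T2Space M] : RegularSpace (Cotangent n M) := by
  have : T2Space (Cotangent n M) := t2Space_totalSpace
  have : FiniteDimensional ℝ (EuclideanSpace ℝ (Fin n) →L[ℝ] ℝ) := inferInstance
  have : LocallyCompactSpace (Cotangent n M) :=
    Manifold.locallyCompact_of_finiteDimensional (cotModel n)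
  infer_instance

/-- The fibre coordinate of the chart of `T^*M` at `z₀` is the covector read in the chart of `M`. -/
lemma extChartAt_cotangent_snd (z₀ z : Cotangent n M)
    (hz : z.1 ∈ (chartAt (EuclideanSpace ℝ (Fin n)) z₀.1).source)
   (w : EuclideanSpace ℝ (Fin n)) :
    (extChartAt (cotModel n) z₀ z).2 w =
      z.2 (mfderiv (𝓡 n) (𝓡 n) (extChartAt (𝓡 n) z₀.1).symm (extChartAt (𝓡 n) z₀.1 z.1) w) := by
  have h1 := TangentBundle.symmL_trivializationAt (I := 𝓡 n) hz
  rw [ModelWithCorners.range_eq_univ, mfderivWithin_univ] at h1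
  have h2 : (extChartAt (cotModel n) z₀ z).2 = ContinuousLinearMap.inCoordinates
      (EuclideanSpace ℝ (Fin n)) (TangentSpace (𝓡 n)) ℝ (Bundle.Trivial M ℝ) z₀.1 z.1 z₀.1 z.1 z.2 := by
    exact congrArg Prod.snd (hom_chart (F₁ := EuclideanSpace ℝ (Fin n)) (F₂ := ℝ)
      (E₁ := TangentSpace (𝓡 n)) (E₂ := Bundle.Trivial M ℝ) z₀ z)
  rw [h2, ← h1]
  simp [ContinuousLinearMap.inCoordinates]
  rfl

lemma proj_extChartAt_symm (z₀ : Cotangent n M)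
    {y : EuclideanSpace ℝ (Fin n) × (EuclideanSpace ℝ (Fin n) →L[ℝ] ℝ)}
    (hy : y ∈ (extChartAt (cotModel n) z₀).target) :
    ((extChartAt (cotModel n) z₀).symm y).proj = (extChartAt (𝓡 n) z₀.1).symm y.1 := by
  have := FiberBundle.chartedSpace_chartAt_symm_fst
    (HB := EuclideanSpace ℝ (Fin n)) (F := EuclideanSpace ℝ (Fin n) →L[ℝ] ℝ) z₀ y
    (by simpa [extChartAt] using! hy)
  simpa [extChartAt] using! this

/-- In the charts of `T^*M`, the Liouville form is `p dq`. -/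
theorem liouville_inExtChartAt (z₀ : Cotangent n M)
    {y : EuclideanSpace ℝ (Fin n) × (EuclideanSpace ℝ (Fin n) →L[ℝ] ℝ)}
    (hy : y ∈ (extChartAt (cotModel n) z₀).target) :
    OneForm.inExtChart (liouville n M) z₀ y = y.2.comp (ContinuousLinearMap.fst ℝ _ _) := by
  set z := (extChartAt (cotModel n) z₀).symm y with hz
  have hyz : extChartAt (cotModel n) z₀ z = y := (extChartAt (cotModel n) z₀).right_inv hy
  have hyt : y.1 ∈ (extChartAt (𝓡 n) z₀.1).target := by
    rw [FiberBundle.extChartAt_target] at hy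
    exact hy.1.1
  have hz1 : z.1 = (extChartAt (𝓡 n) z₀.1).symm y.1 := proj_extChartAt_symm z₀ hy
  have hzb : z.1 ∈ (chartAt (EuclideanSpace ℝ (Fin n)) z₀.1).source := by
    rw [hz1, ← extChartAt_source (𝓡 n)]
    exact (extChartAt (𝓡 n) z₀.1).map_target hyt
  have hy1 : extChartAt (𝓡 n) z₀.1 z.1 = y.1 := by
    rw [hz1]
    exact (extChartAt (𝓡 n) z₀.1).right_inv hyt
  refine ContinuousLinearMap.ext fun v => ?_
  have h1 : mfderiv (cotModel n) (𝓡 n) (TotalSpace.proj : Cotangent n M → M) z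
      (mfderiv 𝓘(ℝ, EuclideanSpace ℝ (Fin n) × (EuclideanSpace ℝ (Fin n) →L[ℝ] ℝ)) (cotModel n)
        (extChartAt (cotModel n) z₀).symm y v) =
      mfderiv (𝓡 n) (𝓡 n) (extChartAt (𝓡 n) z₀.1).symm y.1 v.1 := by
    have d1 : MDifferentiableAt (cotModel n) (𝓡 n) (TotalSpace.proj : Cotangent n M → M) z :=
      mdifferentiableAt_proj _
    have d2 : MDifferentiableAt
        𝓘(ℝ, EuclideanSpace ℝ (Fin n) × (EuclideanSpace ℝ (Fin n) →L[ℝ] ℝ)) (cotModel n)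
        (extChartAt (cotModel n) z₀).symm y := by
      have := mdifferentiableWithinAt_extChartAt_symm hy
      rwa [ModelWithCorners.range_eq_univ, mdifferentiableWithinAt_univ] at this
    have d3 : MDifferentiableAt (𝓡 n) (𝓡 n) (extChartAt (𝓡 n) z₀.1).symm y.1 := by
      have := mdifferentiableWithinAt_extChartAt_symm hyt
      rwa [ModelWithCorners.range_eq_univ, mdifferentiableWithinAt_univ] at this
    have d4 := (hasFDerivAt_fst (𝕜 := ℝ) (E := EuclideanSpace ℝ (Fin n))
      (F := EuclideanSpace ℝ (Fin n) →L[ℝ] ℝ) (p := y)).hasMFDerivAt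
    have c1 := d1.hasMFDerivAt.comp y d2.hasMFDerivAt
    have c2 := d3.hasMFDerivAt.comp y d4
    have c3 : (TotalSpace.proj : Cotangent n M → M) ∘ (extChartAt (cotModel n) z₀).symm =ᶠ[𝓝 y]
        (extChartAt (𝓡 n) z₀.1).symm ∘ Prod.fst := by
      filter_upwards [(isOpen_extChartAt_target z₀).mem_nhds hy] with y' hy'
      exact proj_extChartAt_symm z₀ hy'
    exact congrArg (fun L => L v) (hasMFDerivAt_unique c1 (c2.congr_of_eventuallyEq c3))
  have h2 := extChartAt_cotangent_snd z₀ z hzb v.1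
  rw [hyz, hy1] at h2
  exact (congrArg z.2 h1).trans h2.symm


/-- In the charts of `T^*M`, the exterior derivative of the Liouville form is `dp ∧ dq`. -/
theorem extDeriv_liouville_inExtChartAt (z₀ : Cotangent n M)
    {y : EuclideanSpace ℝ (Fin n) × (EuclideanSpace ℝ (Fin n) →L[ℝ] ℝ)}
    (hy : y ∈ (extChartAt (cotModel n) z₀).target)
    (v : Fin 2 → EuclideanSpace ℝ (Fin n) × (EuclideanSpace ℝ (Fin n) →L[ℝ] ℝ)) :
    _root_.extDeriv (fun y => ContinuousAlternatingMap.ofSubsingleton ℝ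
        (EuclideanSpace ℝ (Fin n) × (EuclideanSpace ℝ (Fin n) →L[ℝ] ℝ)) ℝ (0 : Fin 1)
        (OneForm.inExtChart (liouville n M) z₀ y)) y v =
      (v 0).2 (v 1).1 - (v 1).2 (v 0).1 := by
  have hα : ∀ᶠ y' in 𝓝 y, OneForm.inExtChart (liouville n M) z₀ y' =
      y'.2.comp (ContinuousLinearMap.fst ℝ _ _) := by
    filter_upwards [(isOpen_extChartAt_target z₀).mem_nhds hy] with y' hy'
    exact liouville_inExtChartAt z₀ hy'
  exact extDeriv_eq_of_eventuallyEq_tautological (V := EuclideanSpace ℝ (Fin n))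
    (α := OneForm.inExtChart (liouville n M) z₀) hα v

end Bundle

/-! ### Distances of smooth metrics and equi-Lipschitz sequences in charts -/

section MetricDistance

variable {E : Type*} [NormedAddCommGroup E] [NormedSpace ℝ E] {H : Type*} [TopologicalSpace H]
  {I : ModelWithCorners ℝ E H} {X : Type*} [TopologicalSpace X] [ChartedSpace H X]
  [IsManifold I ∞ X]

namespace RiemMetric

lemma isContinuousRiemannianBundle (g : RiemMetric I X) :
    letI : RiemannianBundle (fun x : X => TangentSpace I x) := ⟨g.toRiemannianMetric⟩
    IsContinuousRiemannianBundle E (fun x : X => TangentSpace I x) :=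
  letI : RiemannianBundle (fun x : X => TangentSpace I x) := ⟨g.toRiemannianMetric⟩
  ⟨⟨g.inner, g.contMDiff.continuous, fun _ _ _ => rfl⟩⟩

lemma dist_comm (g : RiemMetric I X) (x y : X) : g.dist x y = g.dist y x :=
  letI : RiemannianBundle (fun x : X => TangentSpace I x) := ⟨g.toRiemannianMetric⟩
  Manifold.riemannianEDist_comm

lemma dist_triangle (g : RiemMetric I X) (x y z : X) : g.dist x z ≤ g.dist x y + g.dist y z :=
  letI : RiemannianBundle (fun x : X => TangentSpace I x) := ⟨g.toRiemannianMetric⟩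
  Manifold.riemannianEDist_triangle

lemma eventually_dist_lt (g : RiemMetric I X) (x : X) {c : ℝ≥0∞} (hc : 0 < c) :
    ∀ᶠ y in 𝓝 x, g.dist x y < c :=
  letI : RiemannianBundle (fun x : X => TangentSpace I x) := ⟨g.toRiemannianMetric⟩
  haveI : IsManifold I 1 X := .of_le (n := ∞) (by norm_cast)
  haveI := g.isContinuousRiemannianBundle
  eventually_riemannianEDist_lt I x hc

theorem exists_edist_extChartAt_le (g : RiemMetric I X) [RegularSpace X] (x : X) :
    ∃ C : ℝ≥0, ∃ c : ℝ≥0, 0 < c ∧ (∀ y, g.dist x y < c → y ∈ (chartAt H x).source) ∧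
      ∀ y z, g.dist x y < c → g.dist x z < c →
        edist (extChartAt I x y) (extChartAt I x z) ≤ C * g.dist y z :=
  letI : RiemannianBundle (fun x : X => TangentSpace I x) := ⟨g.toRiemannianMetric⟩
  haveI : IsManifold I 1 X := .of_le (n := ∞) (by norm_cast)
  haveI := g.isContinuousRiemannianBundle
  exists_edist_extChartAt_le_riemannianEDist x

variable {N : Type*} [TopologicalSpace N] [ChartedSpace E N] [IsManifold 𝓘(ℝ, E) ∞ N]
  {e : OpenPartialHomeomorph N E}

lemma exists_dist_symm_le (g : RiemMetric 𝓘(ℝ, E) N)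
    (he : e ∈ IsManifold.maximalAtlas 𝓘(ℝ, E) ∞ N) {y₀ : E} (hy₀ : y₀ ∈ e.target) :
    ∃ C : ℝ≥0, ∃ r > 0, Metric.ball y₀ r ⊆ e.target ∧ ∀ y ∈ Metric.ball y₀ r,
      ∀ y' ∈ Metric.ball y₀ r, g.dist (e.symm y) (e.symm y') ≤ C * edist y y' :=
  letI : RiemannianBundle (fun x : N => TangentSpace 𝓘(ℝ, E) x) := ⟨g.toRiemannianMetric⟩
  haveI : IsManifold 𝓘(ℝ, E) 1 N := .of_le (n := ∞) (by norm_cast)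
  haveI := g.isContinuousRiemannianBundle
  exists_riemannianEDist_symm_le he hy₀

lemma abs_fderiv_le (g : RiemMetric 𝓘(ℝ, E) N)
    (he : e ∈ IsManifold.maximalAtlas 𝓘(ℝ, E) ∞ N) {y₀ : E} (hy₀ : y₀ ∈ e.target) {S : N → ℝ}
    {K : ℝ≥0} (hS : ∀ x y, edist (S x) (S y) ≤ K * g.dist x y) {s' : E →L[ℝ] ℝ}
    (hs' : HasFDerivAt (S ∘ e.symm) s' y₀) (w : E) :
    |s' w| ≤ K * g.length (e.symm y₀) (mfderiv 𝓘(ℝ, E) 𝓘(ℝ, E) e.symm y₀ w) := by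
  let : RiemannianBundle (fun x : N => TangentSpace 𝓘(ℝ, E) x) := ⟨g.toRiemannianMetric⟩
  have : IsManifold 𝓘(ℝ, E) 1 N := .of_le (n := ∞) (by norm_cast)
  have := g.isContinuousRiemannianBundle
  refine (abs_fderiv_le_of_lipschitz he hy₀ hS hs' w).trans (le_of_eq ?_)
  congr 1

end RiemMetric

/-- An equi-Lipschitz sequence which converges uniformly for the Riemannian distances is, in charts
around any point, uniformly Lipschitz and uniformly convergent on a fixed ball. -/
theorem exists_chart_control {E' : Type*} [NormedAddCommGroup E'] [NormedSpace ℝ E']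
    {N : Type*} [TopologicalSpace N] [ChartedSpace E' N] [IsManifold 𝓘(ℝ, E') ∞ N]
    [RegularSpace X] (gN : RiemMetric 𝓘(ℝ, E') N) (gX : RiemMetric I X)
    {ι : N → X} {ιk : ℕ → N → X} {K : ℝ≥0} (hι : Continuous ι)
    (hK : ∀ k x y, gX.dist (ιk k x) (ιk k y) ≤ K * gN.dist x y)
    (hu : ∀ ε : ℝ≥0∞, 0 < ε → ∀ᶠ k in atTop, ∀ x, gX.dist (ιk k x) (ι x) < ε)
    {e : OpenPartialHomeomorph N E'} (he : e ∈ IsManifold.maximalAtlas 𝓘(ℝ, E') ∞ N)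
    {y₀ : E'} (hy₀ : y₀ ∈ e.target) :
    ∃ r > 0, ∃ C : ℝ≥0, Metric.ball y₀ r ⊆ e.target ∧
      (∀ y ∈ Metric.ball y₀ r, ι (e.symm y) ∈ (chartAt H (ι (e.symm y₀))).source) ∧
      (∀ᶠ k in atTop, ∀ y ∈ Metric.ball y₀ r,
        ιk k (e.symm y) ∈ (chartAt H (ι (e.symm y₀))).source) ∧
      (∀ᶠ k in atTop, LipschitzOnWith C
        (fun y => extChartAt I (ι (e.symm y₀)) (ιk k (e.symm y))) (Metric.ball y₀ r)) ∧
      TendstoUniformlyOn (fun k y => extChartAt I (ι (e.symm y₀)) (ιk k (e.symm y)))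
        (fun y => extChartAt I (ι (e.symm y₀)) (ι (e.symm y))) atTop (Metric.ball y₀ r) := by
  set z₀ := ι (e.symm y₀)
  obtain ⟨C₁, c, hc, hcs, hC₁⟩ := gX.exists_edist_extChartAt_le z₀
  obtain ⟨C₂, r₂, hr₂, hr₂e, hC₂⟩ := gN.exists_dist_symm_le he hy₀
  have hc2 : (0 : ℝ≥0∞) < (c / 2 : ℝ≥0) := by
    rw [ENNReal.coe_pos]; positivity
  have hcc : ((c / 2 : ℝ≥0) : ℝ≥0∞) + (c / 2 : ℝ≥0) = c := by
    rw [← ENNReal.coe_add, add_halves]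
  have hcont : ContinuousAt (fun y => ι (e.symm y)) y₀ :=
    hι.continuousAt.comp (e.continuousAt_symm hy₀)
  have hev : ∀ᶠ y in 𝓝 y₀, gX.dist z₀ (ι (e.symm y)) < (c / 2 : ℝ≥0) :=
    hcont.eventually (gX.eventually_dist_lt z₀ hc2)
  obtain ⟨r₁, hr₁, hr₁c⟩ := Metric.eventually_nhds_iff_ball.1 hev
  have hι1 : ∀ y ∈ Metric.ball y₀ (min r₁ r₂), gX.dist z₀ (ι (e.symm y)) < (c / 2 : ℝ≥0) :=
    fun y hy => hr₁c y (Metric.ball_subset_ball (min_le_left _ _) hy)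
  have hι2 : ∀ y ∈ Metric.ball y₀ (min r₁ r₂), gX.dist z₀ (ι (e.symm y)) < c := fun y hy =>
    (hι1 y hy).trans_le (by rw [← hcc]; exact le_self_add)
  have hιk : ∀ᶠ k in atTop, ∀ y ∈ Metric.ball y₀ (min r₁ r₂),
      gX.dist z₀ (ιk k (e.symm y)) < c := by
    filter_upwards [hu _ hc2] with k hk y hy
    refine (gX.dist_triangle _ (ι (e.symm y)) _).trans_lt ?_
    rw [gX.dist_comm (ι (e.symm y)), ← hcc]
    exact ENNReal.add_lt_add (hι1 y hy) (hk _)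
  refine ⟨min r₁ r₂, lt_min hr₁ hr₂, C₁ * (K * C₂),
    (Metric.ball_subset_ball (min_le_right _ _)).trans hr₂e, fun y hy => hcs _ (hι2 y hy),
    hιk.mono fun k hk y hy => hcs _ (hk y hy), ?_, ?_⟩
  · filter_upwards [hιk] with k hk y hy y' hy'
    refine (hC₁ _ _ (hk y hy) (hk y' hy')).trans ?_
    push_cast
    rw [mul_assoc, mul_assoc]
    gcongr
    refine (hK k _ _).trans ?_
    gcongr
    exact hC₂ y (Metric.ball_subset_ball (min_le_right _ _) hy) y'
      (Metric.ball_subset_ball (min_le_right _ _) hy')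
  · rw [EMetric.tendstoUniformlyOn_iff]
    intro ε hε
    have hε' : 0 < ε / (C₁ + 1 : ℝ≥0) := ENNReal.div_pos hε.ne' ENNReal.coe_ne_top
    filter_upwards [hιk, hu _ hε'] with k hk hk' y hy
    rw [edist_comm]
    refine (hC₁ _ _ (hk y hy) (hι2 y hy)).trans_lt ?_
    calc (C₁ : ℝ≥0∞) * gX.dist (ιk k (e.symm y)) (ι (e.symm y))
        ≤ (C₁ + 1 : ℝ≥0) * gX.dist (ιk k (e.symm y)) (ι (e.symm y)) := by
          gcongr; exact le_self_add
      _ < (C₁ + 1 : ℝ≥0) * (ε / (C₁ + 1 : ℝ≥0)) := by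
          refine (ENNReal.mul_lt_mul_iff_right ?_ ENNReal.coe_ne_top).2 (hk' _)
          simp
      _ ≤ ε := ENNReal.mul_div_le

end MetricDistance

section Forms

variable {E : Type*} [NormedAddCommGroup E] [NormedSpace ℝ E] {H : Type*} [TopologicalSpace H]
  {I : ModelWithCorners ℝ E H} {X : Type*} [TopologicalSpace X] [ChartedSpace H X]

/-- The expression of a one-form in a chart, applied to a tangent vector read in the same chart, gives
back the value of the form. -/
lemma inExtChart_mfderiv [I.Boundaryless] [IsManifold I 1 X] (α : OneForm I X) (z₀ : X) {z : X}
    (hz : z ∈ (chartAt H z₀).source) (u : TangentSpace I z) :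
    OneForm.inExtChart α z₀ (extChartAt I z₀ z) (mfderiv I 𝓘(ℝ, E) (extChartAt I z₀) z u) =
      α z u := by
  have hz' : z ∈ (extChartAt I z₀).source := by rwa [extChartAt_source]
  have hzz : (extChartAt I z₀).symm (extChartAt I z₀ z) = z := (extChartAt I z₀).left_inv hz'
  have h1 := mfderivWithin_extChartAt_symm_comp_mfderiv_extChartAt' (I := I) hz'
  rw [ModelWithCorners.range_eq_univ, mfderivWithin_univ] at h1
  have h2 : mfderiv 𝓘(ℝ, E) I (extChartAt I z₀).symm (extChartAt I z₀ z)
      (mfderiv I 𝓘(ℝ, E) (extChartAt I z₀) z u) = u := congrArg (fun L => L u) h1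
  have h3 : ∀ z', z' = z → ∀ w : E, (α z' : E →L[ℝ] ℝ) w = (α z : E →L[ℝ] ℝ) w := by
    rintro _ rfl _; rfl
  exact (h3 _ hzz _).trans (congrArg (α z) h2)

end Forms

/-! ### The pullbacks of the Liouville and symplectic forms at a point of differentiability -/

section Charts

variable {E : Type*} [NormedAddCommGroup E] [NormedSpace ℝ E]
  {N : Type*} [TopologicalSpace N] [ChartedSpace E N]
  {e : OpenPartialHomeomorph N E}

lemma mdifferentiable_of_mem_maximalAtlas (he : e ∈ IsManifold.maximalAtlas 𝓘(ℝ, E) ∞ N) :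
    e.MDifferentiable 𝓘(ℝ, E) 𝓘(ℝ, E) :=
  ⟨(contMDiffOn_of_mem_maximalAtlas he).mdifferentiableOn (by simp),
    (contMDiffOn_symm_of_mem_maximalAtlas he).mdifferentiableOn (by simp)⟩

lemma mfderiv_symm_mfderiv (he : e ∈ IsManifold.maximalAtlas 𝓘(ℝ, E) ∞ N) {y : E}
    (hy : y ∈ e.target) (u : TangentSpace 𝓘(ℝ, E) (e.symm y)) :
    mfderiv 𝓘(ℝ, E) 𝓘(ℝ, E) e.symm y (mfderiv 𝓘(ℝ, E) 𝓘(ℝ, E) e (e.symm y) u) = u := by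
  have h := (mdifferentiable_of_mem_maximalAtlas he).symm_comp_deriv (e.map_target hy)
  rw [e.right_inv hy] at h
  exact congrArg (fun L => L u) h

variable {E' : Type*} [NormedAddCommGroup E'] [NormedSpace ℝ E'] {H' : Type*}
  [TopologicalSpace H'] {I' : ModelWithCorners ℝ E' H'} {X : Type*} [TopologicalSpace X]
  [ChartedSpace H' X] [IsManifold I' 1 X]

lemma hasFDerivAt_inCharts (he : e ∈ IsManifold.maximalAtlas 𝓘(ℝ, E) ∞ N) {y : E}
    (hy : y ∈ e.target) {f : N → X} (hf : MDifferentiableAt 𝓘(ℝ, E) I' f (e.symm y)) {z₀ : X}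
    (hz : f (e.symm y) ∈ (chartAt H' z₀).source) :
    HasFDerivAt (fun y => extChartAt I' z₀ (f (e.symm y)))
      ((mfderiv I' 𝓘(ℝ, E') (extChartAt I' z₀) (f (e.symm y))).comp
        ((mfderiv 𝓘(ℝ, E) I' f (e.symm y)).comp (mfderiv 𝓘(ℝ, E) 𝓘(ℝ, E) e.symm y)) : E →L[ℝ] E')
      y := by
  have h1 : HasMFDerivAt 𝓘(ℝ, E) 𝓘(ℝ, E) e.symm y (mfderiv 𝓘(ℝ, E) 𝓘(ℝ, E) e.symm y) :=
    ((mdifferentiable_of_mem_maximalAtlas he).mdifferentiableAt_symm hy).hasMFDerivAt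
  have h2 := (mdifferentiableAt_extChartAt (I := I') hz).hasMFDerivAt
  exact (h2.comp y (hf.hasMFDerivAt.comp y h1)).hasFDerivAt

lemma hasFDerivAt_inChart (he : e ∈ IsManifold.maximalAtlas 𝓘(ℝ, E) ∞ N) {y : E}
    (hy : y ∈ e.target) {f : N → ℝ} (hf : MDifferentiableAt 𝓘(ℝ, E) 𝓘(ℝ, ℝ) f (e.symm y)) :
    HasFDerivAt (f ∘ e.symm)
      ((mfderiv 𝓘(ℝ, E) 𝓘(ℝ, ℝ) f (e.symm y)).comp (mfderiv 𝓘(ℝ, E) 𝓘(ℝ, E) e.symm y) :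
        E →L[ℝ] ℝ) y := by
  have h1 : HasMFDerivAt 𝓘(ℝ, E) 𝓘(ℝ, E) e.symm y (mfderiv 𝓘(ℝ, E) 𝓘(ℝ, E) e.symm y) :=
    ((mdifferentiable_of_mem_maximalAtlas he).mdifferentiableAt_symm hy).hasMFDerivAt
  exact (hf.hasMFDerivAt.comp y h1).hasFDerivAt

omit [IsManifold I' 1 X] in
lemma mdifferentiableAt_of_comp_symm (he : e ∈ IsManifold.maximalAtlas 𝓘(ℝ, E) ∞ N) {y : E}
    (hy : y ∈ e.target) {f : N → X}
    (hf : MDifferentiableAt 𝓘(ℝ, E) I' (fun y => f (e.symm y)) y) :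
    MDifferentiableAt 𝓘(ℝ, E) I' f (e.symm y) := by
  have h1 := (mdifferentiable_of_mem_maximalAtlas he).mdifferentiableAt (e.map_target hy)
  have h2 : MDifferentiableAt 𝓘(ℝ, E) I' (fun y => f (e.symm y)) (e (e.symm y)) := by
    rwa [e.right_inv hy]
  refine (h2.comp (e.symm y) h1).congr_of_eventuallyEq ?_
  filter_upwards [e.open_source.mem_nhds (e.map_target hy)] with x hx
  simp [e.left_inv hx]

lemma mdifferentiableAt_of_inCharts [I'.Boundaryless]
    (he : e ∈ IsManifold.maximalAtlas 𝓘(ℝ, E) ∞ N) {y : E}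
    (hy : y ∈ e.target) {f : N → X} {z₀ : X}
    (hz : ∀ᶠ y' in 𝓝 y, f (e.symm y') ∈ (chartAt H' z₀).source)
    (hf : DifferentiableAt ℝ (fun y => extChartAt I' z₀ (f (e.symm y))) y) :
    MDifferentiableAt 𝓘(ℝ, E) I' f (e.symm y) := by
  refine mdifferentiableAt_of_comp_symm he hy ?_
  have hzy : extChartAt I' z₀ (f (e.symm y)) ∈ (extChartAt I' z₀).target :=
    (extChartAt I' z₀).map_source (by rw [extChartAt_source]; exact hz.self_of_nhds)
  have h1 := mdifferentiableWithinAt_extChartAt_symm hzy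
  rw [ModelWithCorners.range_eq_univ, mdifferentiableWithinAt_univ] at h1
  refine (h1.comp y hf.mdifferentiableAt).congr_of_eventuallyEq ?_
  filter_upwards [hz] with y' hy'
  exact ((extChartAt I' z₀).left_inv (by rwa [extChartAt_source])).symm

end Charts

section Brane

variable {n : ℕ} {M : Type*} [TopologicalSpace M] [T2Space M]
  [ChartedSpace (EuclideanSpace ℝ (Fin n)) M] [IsManifold (𝓡 n) ∞ M]
  {N : Type*} [TopologicalSpace N]
  [ChartedSpace (EuclideanSpace ℝ (Fin n)) N] [IsManifold (𝓡 n) ∞ N]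
  {gN : RiemMetric (𝓡 n) N} {gX : RiemMetric (cotModel n) (Cotangent n M)}
  {ι : N → Cotangent n M} {S : N → ℝ}

/-- At every point where `ι` and `S` are differentiable, `ι^*θ = dS` and `ι^*ω = 0`. The chart of
`T^*M` is the one at the image point, which is the chart computing the exterior derivative there. -/
theorem IsLipschitzExactBrane.pullback_eq_of_mdifferentiableAt
    (h : IsLipschitzExactBrane gN gX ι S)
    {e : OpenPartialHomeomorph N (EuclideanSpace ℝ (Fin n))}
    (he : e ∈ IsManifold.maximalAtlas (𝓡 n) ∞ N) {y : EuclideanSpace ℝ (Fin n)}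
    (hy : y ∈ e.target) (hι : MDifferentiableAt (𝓡 n) (cotModel n) ι (e.symm y))
    (hS : MDifferentiableAt (𝓡 n) 𝓘(ℝ, ℝ) S (e.symm y)) :
    OneForm.pullback (𝓡 n) ι (liouville n M) (e.symm y) = diff (𝓡 n) S (e.symm y) ∧
      TwoForm.pullback (𝓡 n) ι (symplectic n M) (e.symm y) = 0 := by
  have : RegularSpace (Cotangent n M) := regularSpace_cotangent
  have : IsManifold (cotModel n) 1 (Cotangent n M) := .of_le (n := ∞) (by norm_cast)
  obtain ⟨ιk, Sk, K, hemb, hSk, hιK, -, hexact, hιu, hSu⟩ := h.exists_approx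
  obtain ⟨r, hr, C, hre, hs, hsk, hlip, hunif⟩ :=
    exists_chart_control gN gX h.continuous_map hιK hιu he hy
  set z₀ := ι (e.symm y) with hz₀
  have hmem : y ∈ Metric.ball y r := Metric.mem_ball_self hr
  have hk : ∀ᶠ k in atTop, ∀ y' ∈ Metric.ball y r,
      DifferentiableAt ℝ (fun y => extChartAt (cotModel n) z₀ (ιk k (e.symm y))) y' ∧
      ‖fderiv ℝ (fun y => extChartAt (cotModel n) z₀ (ιk k (e.symm y))) y'‖ ≤ C ∧
      HasFDerivAt (Sk k ∘ e.symm)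
        ((extChartAt (cotModel n) z₀ (ιk k (e.symm y'))).2.comp
          ((ContinuousLinearMap.fst ℝ _ _).comp
            (fderiv ℝ (fun y => extChartAt (cotModel n) z₀ (ιk k (e.symm y))) y'))) y' := by
    filter_upwards [hsk, hlip] with k hsk hlip y' hy'
    obtain ⟨L, hd1, hL⟩ : ∃ L : EuclideanSpace ℝ (Fin n) →L[ℝ]
          EuclideanSpace ℝ (Fin n) × (EuclideanSpace ℝ (Fin n) →L[ℝ] ℝ),
        HasFDerivAt (fun y => extChartAt (cotModel n) z₀ (ιk k (e.symm y))) L y' ∧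
          ∀ v, L v = mfderiv (cotModel n)
            𝓘(ℝ, EuclideanSpace ℝ (Fin n) × (EuclideanSpace ℝ (Fin n) →L[ℝ] ℝ))
            (extChartAt (cotModel n) z₀) (ιk k (e.symm y'))
            (mfderiv (𝓡 n) (cotModel n) (ιk k) (e.symm y') (mfderiv (𝓡 n) (𝓡 n) e.symm y' v)) :=
      ⟨_, hasFDerivAt_inCharts he (hre hy')
        ((hemb k).contMDiff.mdifferentiableAt (by simp)) (hsk y' hy'), fun _ => rfl⟩
    refine ⟨hd1.differentiableAt,
      norm_fderiv_le_of_lipschitzOn ℝ (Metric.isOpen_ball.mem_nhds hy') hlip, ?_⟩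
    obtain ⟨L', hd2, hL'⟩ : ∃ L' : EuclideanSpace ℝ (Fin n) →L[ℝ] ℝ,
        HasFDerivAt (Sk k ∘ e.symm) L' y' ∧
          ∀ v, L' v = diff (𝓡 n) (Sk k) (e.symm y') (mfderiv (𝓡 n) (𝓡 n) e.symm y' v) :=
      ⟨_, hasFDerivAt_inChart he (hre hy')
        ((hSk k).mdifferentiableAt (x := e.symm y') (by simp)), fun _ => rfl⟩
    refine hd2.congr_fderiv (ContinuousLinearMap.ext fun v => ?_)
    rw [hd1.fderiv]
    have h1 := inExtChart_mfderiv (liouville n M) z₀ (hsk y' hy')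
      (mfderiv (𝓡 n) (cotModel n) (ιk k) (e.symm y') (mfderiv (𝓡 n) (𝓡 n) e.symm y' v))
    rw [liouville_inExtChartAt z₀ ((extChartAt (cotModel n) z₀).map_source
      (by rw [extChartAt_source]; exact hsk y' hy'))] at h1
    have h2 := congrFun (hexact k) (e.symm y')
    have h3 := congrArg (fun L => L (mfderiv (𝓡 n) (𝓡 n) e.symm y' v)) h2
    exact (hL' v).trans (h3.symm.trans (h1.symm.trans (congrArg
      (fun w => (extChartAt (cotModel n) z₀ (ιk k (e.symm y'))).2 w.1)
      (hL v).symm)))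
  have hd := hasFDerivAt_inCharts he hy hι (hs y hmem)
  have hdS := hasFDerivAt_inChart he hy hS
  obtain ⟨h1, h2⟩ := limit_of_exact_approximations hr C.coe_nonneg hk hunif
    (fun y' _ => hSu.tendsto_at (e.symm y')) hd hdS
  -- the derivative of `ι`, read in the chart at `z₀`
  let D : TangentSpace (𝓡 n) (e.symm y) →
      EuclideanSpace ℝ (Fin n) × (EuclideanSpace ℝ (Fin n) →L[ℝ] ℝ) := fun u =>
    mfderiv (cotModel n) 𝓘(ℝ, EuclideanSpace ℝ (Fin n) × (EuclideanSpace ℝ (Fin n) →L[ℝ] ℝ))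
      (extChartAt (cotModel n) z₀) (ι (e.symm y)) (mfderiv (𝓡 n) (cotModel n) ι (e.symm y) u)
  have hD : ∀ u, D (mfderiv (𝓡 n) (𝓡 n) e.symm y (mfderiv (𝓡 n) (𝓡 n) e (e.symm y) u)) = D u :=
    fun u => congrArg D (mfderiv_symm_mfderiv he hy u)
  constructor
  · refine ContinuousLinearMap.ext fun u => ?_
    have h3 := inExtChart_mfderiv (liouville n M) z₀ (hs y hmem)
      (mfderiv (𝓡 n) (cotModel n) ι (e.symm y) u)
    rw [liouville_inExtChartAt z₀ ((extChartAt (cotModel n) z₀).map_source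
      (by rw [extChartAt_source]; exact hs y hmem))] at h3
    have h4 := h1 (mfderiv (𝓡 n) (𝓡 n) e (e.symm y) u)
    have h5 := congrArg (fun w => (extChartAt (cotModel n) z₀ (ι (e.symm y))).2 w.1) (hD u)
    have h6 := congrArg (fun u => diff (𝓡 n) S (e.symm y) u) (mfderiv_symm_mfderiv he hy u)
    exact h3.symm.trans (h5.symm.trans (h4.symm.trans h6))
  · refine ContinuousAlternatingMap.ext fun v => ?_
    have h3 := extDeriv_liouville_inExtChartAt z₀ (mem_extChartAt_target z₀) (fun i => D (v i))
    have h4 := h2 (mfderiv (𝓡 n) (𝓡 n) e (e.symm y) (v 0))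
      (mfderiv (𝓡 n) (𝓡 n) e (e.symm y) (v 1))
    have h5 : ∀ a a' b b' : EuclideanSpace ℝ (Fin n) × (EuclideanSpace ℝ (Fin n) →L[ℝ] ℝ),
        a = a' → b = b' → a.2 b.1 = b.2 a.1 → a'.2 b'.1 - b'.2 a'.1 = 0 := by
      rintro a _ b _ rfl rfl h
      exact sub_eq_zero.2 h
    -- `ω = -dθ`, whence the sign
    have h6 := h3.trans (h5 _ _ _ _ (hD (v 0)) (hD (v 1)) h4)
    exact (congrArg Neg.neg h6).trans neg_zero

end Brane

/-! ### Almost everywhere differentiability and the weak differential -/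

section Measure

lemma ae_restrict_of_locally {α : Type*} [TopologicalSpace α] [SecondCountableTopology α]
    [MeasurableSpace α] [OpensMeasurableSpace α] {μ : Measure α} {s : Set α} (hs : IsOpen s)
    {P : α → Prop} (h : ∀ x ∈ s, ∃ u ∈ 𝓝 x, ∀ᵐ z ∂μ, z ∈ u → P z) :
    ∀ᵐ z ∂μ.restrict s, P z := by
  rw [ae_restrict_iff' hs.measurableSet]
  refine measure_null_of_locally_null _ fun x hx => ?_
  have hx' : x ∈ s := by
    by_contra hxs
    exact hx fun h => absurd h hxs
  obtain ⟨u, hu, h⟩ := h x hx'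
  refine ⟨u ∩ {z | ¬ (z ∈ s → P z)}, inter_mem (mem_nhdsWithin_of_mem_nhds hu)
    self_mem_nhdsWithin, measure_mono_null (fun z hz => ?_) h⟩
  exact fun hzP => hz.2 fun _ => hzP hz.1

variable {E : Type*} [NormedAddCommGroup E] [NormedSpace ℝ E] [FiniteDimensional ℝ E]
  [MeasurableSpace E] [BorelSpace E] {μ : Measure E} [μ.IsAddHaarMeasure]

/-- Integration by parts against a test function, for a locally Lipschitz function on an open
set. -/
theorem neg_integral_mul_fderiv_eq {U : Set E} (hU : IsOpen U) {f : E → ℝ}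
    (hf : LocallyLipschitzOn U f) {φ : E → ℝ} (hφ : ContDiff ℝ ∞ φ) (hc : HasCompactSupport φ)
    (hφU : tsupport φ ⊆ U) (v : E) :
    -∫ y in U, f y * fderiv ℝ φ y v ∂μ = ∫ y in U, fderiv ℝ f y v * φ y ∂μ := by
  -- replace `f` by a globally Lipschitz function which agrees with it near the support of `φ`
  obtain ⟨L, hL, hφL, hLU⟩ := exists_compact_between hc hU hφU
  obtain ⟨C, hC⟩ := (hf.mono hLU).exists_lipschitzOnWith_of_compact hL
  obtain ⟨g, hg, hfg⟩ := hC.extend_real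
  obtain ⟨D, hD⟩ := hφ.lipschitzWith_of_hasCompactSupport hc (by simp)
  have hev : ∀ y ∈ tsupport φ, f =ᶠ[𝓝 y] g := fun y hy => by
    filter_upwards [isOpen_interior.mem_nhds (hφL hy)] with z hz
    exact hfg (interior_subset hz)
  have h1 : ∀ y, f y * fderiv ℝ φ y v = g y * fderiv ℝ φ y v := fun y => by
    by_cases hy : y ∈ tsupport φ
    · rw [(hev y hy).self_of_nhds]
    · have : fderiv ℝ φ y = 0 := by
        by_contra h
        exact hy (support_fderiv_subset ℝ h)
      simp [this]
  have h2 : ∀ y, fderiv ℝ f y v * φ y = fderiv ℝ g y v * φ y := fun y => by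
    by_cases hy : y ∈ tsupport φ
    · rw [(hev y hy).fderiv_eq]
    · simp [image_eq_zero_of_notMem_tsupport hy]
  have h3 : ∀ y, y ∉ U → g y * fderiv ℝ φ y v = 0 := fun y hy => by
    have : fderiv ℝ φ y = 0 := by
      by_contra h
      exact hy (hφU (support_fderiv_subset ℝ h))
    simp [this]
  have h4 : ∀ y, y ∉ U → fderiv ℝ g y v * φ y = 0 := fun y hy => by
    simp [image_eq_zero_of_notMem_tsupport fun h => hy (hφU h)]
  simp_rw [h1, h2]
  rw [setIntegral_eq_integral_of_forall_compl_eq_zero h3,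
    setIntegral_eq_integral_of_forall_compl_eq_zero h4]
  have h5 := hg.integral_lineDeriv_mul_eq (μ := μ) hD hc v
  have h6 : ∫ y, lineDeriv ℝ g y v * φ y ∂μ = ∫ y, fderiv ℝ g y v * φ y ∂μ := by
    refine integral_congr_ae ?_
    filter_upwards [hg.ae_differentiableAt (μ := μ)] with y hy
    rw [hy.lineDeriv_eq_fderiv]
  have h7 : ∀ y, lineDeriv ℝ φ y (-v) * g y = -(g y * fderiv ℝ φ y v) := fun y => by
    rw [(hφ.differentiable (by simp) y).lineDeriv_eq_fderiv, map_neg]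
    ring
  rw [← h6, h5]
  simp_rw [h7]
  rw [integral_neg]

end Measure

section Lipschitz

variable {n : ℕ} {N : Type*} [TopologicalSpace N]
  [ChartedSpace (EuclideanSpace ℝ (Fin n)) N] [IsManifold (𝓡 n) ∞ N]
  {gN : RiemMetric (𝓡 n) N} {S : N → ℝ} {K : ℝ≥0}
  {e : OpenPartialHomeomorph N (EuclideanSpace ℝ (Fin n))}

lemma locallyLipschitzOn_comp_symm (hS : ∀ x y, edist (S x) (S y) ≤ K * gN.dist x y)
    (he : e ∈ IsManifold.maximalAtlas (𝓡 n) ∞ N) : LocallyLipschitzOn e.target (S ∘ e.symm) := by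
  intro y hy
  obtain ⟨C, r, hr, -, hC⟩ := gN.exists_dist_symm_le he hy
  refine ⟨K * C, Metric.ball y r, mem_nhdsWithin_of_mem_nhds (Metric.ball_mem_nhds y hr),
    fun a ha b hb => (hS _ _).trans ?_⟩
  push_cast
  rw [mul_assoc]
  gcongr
  exact hC a ha b hb

omit [IsManifold (𝓡 n) ∞ N] in
lemma inChart_diff (he : e ∈ IsManifold.maximalAtlas (𝓡 n) ∞ N) {y : EuclideanSpace ℝ (Fin n)}
    (hy : y ∈ e.target) (hS : MDifferentiableAt (𝓡 n) 𝓘(ℝ, ℝ) S (e.symm y)) :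
    OneForm.inChart e (diff (𝓡 n) S) y = fderiv ℝ (S ∘ e.symm) y := by
  have h : HasFDerivAt (S ∘ e.symm) (OneForm.inChart e (diff (𝓡 n) S) y) y :=
    hasFDerivAt_inChart he hy hS
  exact h.fderiv.symm

lemma abs_diff_le (hS : ∀ x y, edist (S x) (S y) ≤ K * gN.dist x y)
    (he : e ∈ IsManifold.maximalAtlas (𝓡 n) ∞ N) {y : EuclideanSpace ℝ (Fin n)}
    (hy : y ∈ e.target) (hSd : MDifferentiableAt (𝓡 n) 𝓘(ℝ, ℝ) S (e.symm y))
    (v : TangentSpace (𝓡 n) (e.symm y)) :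
    |diff (𝓡 n) S (e.symm y) v| ≤ K * gN.length (e.symm y) v := by
  have h1 := gN.abs_fderiv_le he hy hS (hasFDerivAt_inChart he hy hSd)
    (mfderiv (𝓡 n) (𝓡 n) e (e.symm y) v)
  rw [mfderiv_symm_mfderiv he hy v] at h1
  have h2 := congrArg (fun u => |diff (𝓡 n) S (e.symm y) u|) (mfderiv_symm_mfderiv he hy v)
  exact h2.symm.le.trans h1

end Lipschitz

section Brane

variable {n : ℕ} {M : Type*} [TopologicalSpace M]
  [ChartedSpace (EuclideanSpace ℝ (Fin n)) M] [IsManifold (𝓡 n) ∞ M]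
  {N : Type*} [TopologicalSpace N]
  [ChartedSpace (EuclideanSpace ℝ (Fin n)) N] [IsManifold (𝓡 n) ∞ N]
  {gN : RiemMetric (𝓡 n) N} {gX : RiemMetric (cotModel n) (Cotangent n M)}
  {ι : N → Cotangent n M} {S : N → ℝ}

namespace IsLipschitzExactBrane

lemma exists_edist_le (h : IsLipschitzExactBrane gN gX ι S) :
    ∃ K : ℝ≥0, ∀ x y, edist (S x) (S y) ≤ K * gN.dist x y := by
  obtain ⟨ιk, Sk, K, -, -, -, hSK, -, -, hSu⟩ := h.exists_approx
  exact ⟨K, fun x y => le_of_tendsto ((hSu.tendsto_at x).edist (hSu.tendsto_at y))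
    (Eventually.of_forall fun k => hSK k x y)⟩

theorem ae_mdifferentiableAt_primitive (h : IsLipschitzExactBrane gN gX ι S) :
    AlmostEverywhere n fun x => MDifferentiableAt (𝓡 n) 𝓘(ℝ, ℝ) S x := by
  intro e he
  obtain ⟨K, hS⟩ := h.exists_edist_le
  refine ae_restrict_of_locally e.open_target fun y hy => ?_
  obtain ⟨C, u, hu, hC⟩ := locallyLipschitzOn_comp_symm hS he hy
  rw [e.open_target.nhdsWithin_eq hy] at hu
  refine ⟨interior u ∩ e.target, inter_mem (interior_mem_nhds.2 hu) (e.open_target.mem_nhds hy), ?_⟩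
  filter_upwards [hC.ae_differentiableWithinAt_of_mem (μ := volume)] with z hz hzu
  exact mdifferentiableAt_of_comp_symm he hzu.2
    ((hz (interior_subset hzu.1)).differentiableAt
      (mem_interior_iff_mem_nhds.1 hzu.1)).mdifferentiableAt

variable [T2Space M] in
theorem ae_mdifferentiableAt_map (h : IsLipschitzExactBrane gN gX ι S) :
    AlmostEverywhere n fun x => MDifferentiableAt (𝓡 n) (cotModel n) ι x := by
  intro e he
  have : RegularSpace (Cotangent n M) := regularSpace_cotangent
  obtain ⟨ιk, Sk, K, -, -, hιK, -, -, hιu, -⟩ := h.exists_approx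
  refine ae_restrict_of_locally e.open_target fun y hy => ?_
  obtain ⟨r, hr, C, hre, hs, -, hlip, hunif⟩ :=
    exists_chart_control gN gX h.continuous_map hιK hιu he hy
  have hL : LipschitzOnWith C
      (fun y' => extChartAt (cotModel n) (ι (e.symm y)) (ι (e.symm y'))) (Metric.ball y r) :=
    fun a ha b hb => le_of_tendsto ((hunif.tendsto_at ha).edist (hunif.tendsto_at hb))
      (hlip.mono fun k hk => hk ha hb)
  refine ⟨Metric.ball y r, Metric.ball_mem_nhds y hr, ?_⟩
  filter_upwards [hL.ae_differentiableWithinAt_of_mem (μ := volume)] with z hz hzr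
  have hnhds := Metric.isOpen_ball.mem_nhds hzr
  exact mdifferentiableAt_of_inCharts he (hre hzr) (eventually_of_mem hnhds hs)
    ((hz hzr).differentiableAt hnhds)

theorem isLinftyOneForm_diff (h : IsLipschitzExactBrane gN gX ι S) :
    IsLinftyOneForm gN (diff (𝓡 n) S) where
  measurable e he := by
    have h1 : Measurable (fderiv ℝ (S ∘ e.symm)) := measurable_fderiv ℝ _
    refine h1.aestronglyMeasurable.congr ?_
    filter_upwards [h.ae_mdifferentiableAt_primitive e he,
      ae_restrict_mem e.open_target.measurableSet] with y hy hye
    exact (inChart_diff he hye hy).symm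
  bounded := by
    obtain ⟨K, hS⟩ := h.exists_edist_le
    refine ⟨K, fun e he => ?_⟩
    filter_upwards [h.ae_mdifferentiableAt_primitive e he,
      ae_restrict_mem e.open_target.measurableSet] with y hy hye
    exact abs_diff_le hS he hye hy

variable [T2Space M] in
theorem ae_pullback_liouville_and_symplectic (h : IsLipschitzExactBrane gN gX ι S) :
    AlmostEverywhere n fun x =>
      OneForm.pullback (𝓡 n) ι (liouville n M) x = diff (𝓡 n) S x ∧
        TwoForm.pullback (𝓡 n) ι (symplectic n M) x = 0 := by
  intro e he
  filter_upwards [h.ae_mdifferentiableAt_primitive e he, h.ae_mdifferentiableAt_map e he,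
    ae_restrict_mem e.open_target.measurableSet] with y hS hι hy
  exact h.pullback_eq_of_mdifferentiableAt he hy hι hS

end IsLipschitzExactBrane

lemma IsLinftyOneForm.congr_ae {α β : OneForm (𝓡 n) N} (hα : IsLinftyOneForm gN α)
    (hαβ : AlmostEverywhere n fun x => β x = α x) : IsLinftyOneForm gN β where
  measurable e he := by
    refine (hα.measurable e he).congr ?_
    filter_upwards [hαβ e he] with y hy
    simp only [OneForm.inChart, hy]
  bounded := by
    obtain ⟨C, hC⟩ := hα.bounded
    refine ⟨C, fun e he => ?_⟩
    filter_upwards [hαβ e he, hC e he] with y hy hCy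
    rwa [hy]

variable [T2Space M] in
theorem IsLipschitzExactBrane.isWeakDifferential (h : IsLipschitzExactBrane gN gX ι S) :
    IsWeakDifferential S (OneForm.pullback (𝓡 n) ι (liouville n M)) := by
  intro e he φ hφ hc hsupp v
  obtain ⟨K, hS⟩ := h.exists_edist_le
  refine (neg_integral_mul_fderiv_eq e.open_target (locallyLipschitzOn_comp_symm hS he) hφ hc
    hsupp v).trans (integral_congr_ae ?_)
  filter_upwards [h.ae_mdifferentiableAt_primitive e he,
    h.ae_pullback_liouville_and_symplectic e he,
    ae_restrict_mem e.open_target.measurableSet] with y hSy hy hye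
  rw [← inChart_diff he hye hSy]
  simp only [OneForm.inChart, hy.1]

end Brane
end LipLag

theorem mainTheorem6 (n : ℕ)
    {M : Type*} [TopologicalSpace M] [T2Space M] [CompactSpace M]
    [ChartedSpace (EuclideanSpace ℝ (Fin n)) M] [IsManifold (𝓡 n) ∞ M]
    {N : Type*} [TopologicalSpace N] [T2Space N] [SecondCountableTopology N]
    [ChartedSpace (EuclideanSpace ℝ (Fin n)) N] [IsManifold (𝓡 n) ∞ N]
    (gN : LipLag.RiemMetric (𝓡 n) N)
    (gX : LipLag.RiemMetric (LipLag.cotModel n) (LipLag.Cotangent n M))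
    (ι : N → LipLag.Cotangent n M) (S : N → ℝ)
    (h : LipLag.IsLipschitzExactBrane gN gX ι S) :
    -- `ι` and `S` are differentiable almost everywhere, so that `ι^*θ`, `dS`, `ι^*ω` make sense
    LipLag.AlmostEverywhere n (fun x =>
      MDifferentiableAt (𝓡 n) (LipLag.cotModel n) ι x ∧
        MDifferentiableAt (𝓡 n) 𝓘(ℝ, ℝ) S x) ∧
    -- `ι^*θ` and `dS` are one-forms in `L^∞`
    LipLag.IsLinftyOneForm gN (LipLag.OneForm.pullback (𝓡 n) ι (LipLag.liouville n M)) ∧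
    LipLag.IsLinftyOneForm gN (LipLag.diff (𝓡 n) S) ∧
    -- `ι^*θ = dS` in `L^∞`
    LipLag.AlmostEverywhere n (fun x =>
      LipLag.OneForm.pullback (𝓡 n) ι (LipLag.liouville n M) x = LipLag.diff (𝓡 n) S x) ∧
    -- `ι^*θ = dS` as currents
    LipLag.IsWeakDifferential S (LipLag.OneForm.pullback (𝓡 n) ι (LipLag.liouville n M)) ∧
    -- `ι^*ω = 0` in `L^∞`
    LipLag.AlmostEverywhere n (fun x =>
      LipLag.TwoForm.pullback (𝓡 n) ι (LipLag.symplectic n M) x = 0) := by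
  have hforms := h.ae_pullback_liouville_and_symplectic
  have hθ := fun e he => (hforms e he).mono fun _ hy => hy.1
  exact ⟨fun e he => (h.ae_mdifferentiableAt_map e he).and (h.ae_mdifferentiableAt_primitive e he),
    h.isLinftyOneForm_diff.congr_ae hθ, h.isLinftyOneForm_diff, hθ, h.isWeakDifferential,
    fun e he => (hforms e he).mono fun _ hy => hy.2⟩
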